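/- Let $r,s\ge 0$ be integers, not both zero. Let $F=[h,\ell_1,\dots,\ell_r,\ell'_1,\dots,\ell'_s]$ be a simple $2$-regular graph, that is, a vertex-disjoint union of $1+r+s$ cycles whose lengths $h,\ell_1,\dots,\ell_r,\ell'_1,\dots,\ell'_s$ are all at least $3$, where the $\ell_i$ are even and the $\ell'_j$ are odd. Let $v$ be the number of vertices of $F$, and set $\ell=\max\{\ell_1,\dots,\ell_r\}$ (if $r>0$) and $\ell'=\max\{\ell'_1,\dots,\ell'_s\}$ (if $s>0$). Suppose that \[ h>\begin{cases} 12r(\ell+3)+7^{s}(2\ell'+1)-6 & \text{if } r,s>0,\\ 2(r+1)(\ell+1)+5 & \text{if } r>0=s,\\ 3\cdot 7^{s-1}(2\ell'+1) & \text{if } s>0=r. \end{cases} \] Then $OP(2,F)$ has a $1$-rotational solution. That is, there is a family $\mathcal S$ (repetitions allowed) of spanning subgraphs of $K_v$, each isomorphic to $F$, such that every edge of $K_v$ lies in exactly two members of $\mathcal S$ (an $F$-factorization of $2K_v$), and there is a group of permutations of the vertices, each mapping the family $\mathcal S$ to itself, which fixes one vertex and acts sharply transitively on the remaining vertices. -/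

import Mathlib

namespace Oberwolfach

/-- The vertex-disjoint union of cycles of lengths `c i`, for `i : ι`. When every `c i` is at
least `3` this is the simple `2`-regular graph whose cycle lengths are the `c i`. -/
def cycleUnion {ι : Type*} (c : ι → ℕ) : SimpleGraph (Σ i, Fin (c i)) where
  Adj x y := ∃ (i : ι) (a b : Fin (c i)),
    x = ⟨i, a⟩ ∧ y = ⟨i, b⟩ ∧ (SimpleGraph.cycleGraph (c i)).Adj a b
  symm := ⟨by
    rintro x y ⟨i, a, b, hx, hy, hab⟩
    exact ⟨i, b, a, hy, hx, hab.symm⟩⟩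
  loopless := ⟨by
    rintro x ⟨i, a, b, hx, hy, hab⟩
    obtain rfl : a = b := by
      have h := hx.symm.trans hy
      simpa using h
    exact hab.ne rfl⟩

/-- The list of cycle lengths `h, ℓ 0, …, ℓ (r - 1), ℓ' 0, …, ℓ' (s - 1)`. -/
def lengths {r s : ℕ} (h : ℕ) (l : Fin r → ℕ) (l' : Fin s → ℕ) : Option (Fin r ⊕ Fin s) → ℕ
  | none => h
  | some (Sum.inl i) => l i
  | some (Sum.inr j) => l' j

open Classical in
/-- `S` is an `F`-factorization of the `lam`-fold complete graph on the vertex set `V`, where `F`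
is a simple graph: a family (factors may be repeated) of spanning subgraphs isomorphic to `F`
which partition the edge multiset, in which each pair of distinct vertices occurs `lam` times. -/
def IsFactorization {V : Type*} {W : Type*} (lam : ℕ) (F : SimpleGraph W)
    (S : Multiset (SimpleGraph V)) : Prop :=
  (∀ G ∈ S, Nonempty (G ≃g F)) ∧
    ∀ x y : V, x ≠ y → S.countP (fun G => G.Adj x y) = lam

/-- The permutation `p` of the vertices is an automorphism of the family `S` of factors:
replacing each factor by its image under `p` gives the same family. -/
def IsAutomorphism {V : Type*} (S : Multiset (SimpleGraph V)) (p : Equiv.Perm V) : Prop :=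
  S.map (fun G => G.map p) = S

/-- `S` is `1`-rotational: it has an automorphism group that fixes one vertex and acts sharply
transitively on the remaining ones. -/
def IsOneRotational {V : Type*} (S : Multiset (SimpleGraph V)) : Prop :=
  ∃ A : Subgroup (Equiv.Perm V), (∀ p ∈ A, IsAutomorphism S p) ∧
    ∃ z : V, (∀ p ∈ A, p z = z) ∧
      ∀ x y : V, x ≠ z → y ≠ z → ∃! p : Equiv.Perm V, p ∈ A ∧ p x = y

end Oberwolfach

namespace Oberwolfach

/-! ### Graceful labellings of a path together with cycles -/

open Multiset (Ico)

/-! Put `n = v - 1`, identify the vertices with `ZMod n` and a fixed point, and delete that point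
from the `h`-cycle. What remains is a path on `h - 1` vertices and the other cycles, with `n`
vertices and `n - 1` edges. Suppose it is labelled by `0, …, n - 1` so that the edge differences are
`1, …, n - 1`. A nonzero residue is represented by exactly two signed differences, `d` and `d - n`,
so the translates modulo `n` cover every pair of residues twice. The two distinct path ends cover
each pair containing the fixed point twice. This is `card_translates` and `exists_oneRotational`; it
remains to construct labellings (`GoodLab`).

The tool is nesting (`HasLab.nest`). If all edges of an outer labelling cross a cut `p`, opening a
gap of size `N` at `p` raises every outer difference by `N`. A labelling on `N` labels fits in the
gap, and an edge of difference `N` joins the two paths. Nesting paths gives prescribed ends and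
makes the path longer without moving its free end (`GoodLab.enlarge`).

An even cycle comes from three interleaved zigzags, two of them closed into a cycle and the third
serving as a piece of path (`alphaLab_even_cycle`). An odd cycle cannot have all its edges cross a
cut. It is therefore made from a strand left open in a crossing labelling and closed by one
additional vertex in the middle, around an existing labelling (`GoodLab.insert_odd`). Size `N` and
path end `z` then become `5N + 8 - 2z` and `2N + 3 - z`, whatever the cycle length; at most
sevenfold growth under this recursion gives the powers of `7`. With both parities present, the odd
cycles are inserted first, the even ones are wrapped around them, and the path is lengthened to the
required size. -/

/-- The absolute difference along an edge. -/
def edgeDiff (e : ℤ × ℤ) : ℤ := |e.1 - e.2|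

/-- The edges joining consecutive vertices of a list. -/
def pathEdges : List ℤ → Multiset (ℤ × ℤ)
  | [] => 0
  | [_] => 0
  | a :: b :: l => (a, b) ::ₘ pathEdges (b :: l)

/-- The edges of the closed walk through the vertices of a list. -/
def cycleEdges (c : List ℤ) : Multiset (ℤ × ℤ) := pathEdges (c ++ c.head?.toList)

/-- The edges of a path together with those of a list of cycles. -/
def labEdges (l : List ℤ) (cs : List (List ℤ)) : Multiset (ℤ × ℤ) :=
  pathEdges l + (cs.map cycleEdges).sum

/-- The vertices of a path together with those of a list of cycles. -/
def labVerts (l : List ℤ) (cs : List (List ℤ)) : Multiset ℤ := (l : Multiset ℤ) + (cs.flatten : List ℤ)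

/-- An edge with exactly one end below `p`. -/
def Crosses (p : ℤ) (e : ℤ × ℤ) : Prop := e.1 < p ↔ ¬ e.2 < p

/-- There is a graceful labelling of the disjoint union of a path on `n - ∑ L` vertices, with ends
labelled `s` and `t`, and of cycles of lengths `L`, all edges of which satisfy `X`. -/
def HasLab (X : ℤ × ℤ → Prop) (n s t : ℤ) (L : List ℕ) : Prop :=
  ∃ (l : List ℤ) (cs : List (List ℤ)), l.head? = some s ∧ l.getLast? = some t ∧
    cs.map List.length = L ∧ labVerts l cs = Ico 0 n ∧
    (labEdges l cs).map edgeDiff = Ico 1 n ∧ ∀ e ∈ labEdges l cs, X e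

/-- A labelling as in `HasLab`, every edge of which crosses `p`. -/
def AlphaLab (p n s t : ℤ) (L : List ℕ) : Prop := HasLab (Crosses p) n s t L

/-- A labelling as in `HasLab` with one end of the path prescribed. -/
def GoodLab (n s : ℤ) (L : List ℕ) : Prop := ∃ t, HasLab (fun _ => True) n s t L

/-- Opens a gap of size `N` at `p`. -/
def gap (p N x : ℤ) : ℤ := if x < p then x else x + N

/-! ### Intervals as multisets -/

theorem card_Ico_int (a b : ℤ) : Multiset.card (Ico a b) = (b - a).toNat := Int.card_Ico a b

/-- Counting replaces any check of injectivity: too few elements to cover the interval and still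
repeat one. All later checks of labels and differences reduce to this. -/
theorem eq_Ico_of_cover {s : Multiset ℤ} {a b : ℤ} (hc : Multiset.card s ≤ (b - a).toNat)
    (h : ∀ x, a ≤ x → x < b → x ∈ s) : s = Ico a b := by
  symm
  apply Multiset.eq_of_le_of_card_le
  · rw [Multiset.le_iff_subset (Multiset.nodup_Ico)]
    intro x hx
    rw [Multiset.mem_Ico] at hx
    exact h x hx.1 hx.2
  · rwa [card_Ico_int]

theorem map_add_Ico (a b c : ℤ) : (Ico a b).map (· + c) = Ico (a + c) (b + c) := by
  apply eq_Ico_of_cover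
  · rw [Multiset.card_map, card_Ico_int]; omega
  · intro x h1 h2
    rw [Multiset.mem_map]
    exact ⟨x - c, by rw [Multiset.mem_Ico]; omega, by omega⟩

theorem map_add_left_Ico (a b c : ℤ) : (Ico a b).map (c + ·) = Ico (c + a) (c + b) := by
  simpa only [add_comm] using map_add_Ico a b c

theorem map_sub_Ico (n : ℤ) : (Ico 0 n).map (n - 1 - ·) = Ico 0 n := by
  apply eq_Ico_of_cover
  · rw [Multiset.card_map, card_Ico_int]
  · intro x h1 h2
    rw [Multiset.mem_map]
    exact ⟨n - 1 - x, by rw [Multiset.mem_Ico]; omega, by omega⟩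

theorem map_gap_Ico {p n N : ℤ} (h0 : 0 ≤ p) (hn : p ≤ n) :
    (Ico 0 n).map (gap p N) = Ico 0 p + Ico (p + N) (n + N) := by
  have : Ico 0 n = Ico 0 p + Ico p n := by
    symm
    apply eq_Ico_of_cover
    · simp only [Multiset.card_add, card_Ico_int]; omega
    · intro x h1 h2
      simp only [Multiset.mem_add, Multiset.mem_Ico]; omega
  rw [this, Multiset.map_add]
  congr 1
  · conv_rhs => rw [← Multiset.map_id (Ico 0 p)]
    apply Multiset.map_congr rfl
    intro x hx
    rw [Multiset.mem_Ico] at hx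
    simp [gap, hx.2]
  · rw [← map_add_Ico]
    apply Multiset.map_congr rfl
    intro x hx
    rw [Multiset.mem_Ico] at hx
    simp [gap, hx.1]

/-! ### Edges of lists -/

theorem pathEdges_map (f : ℤ → ℤ) : ∀ l : List ℤ,
    pathEdges (l.map f) = (pathEdges l).map (Prod.map f f)
  | [] => rfl
  | [_] => rfl
  | a :: b :: l => by
    have := pathEdges_map f (b :: l)
    simp only [List.map_cons, pathEdges, Multiset.map_cons, Prod.map] at this ⊢
    rw [this]

theorem cycleEdges_map (f : ℤ → ℤ) (c : List ℤ) :
    cycleEdges (c.map f) = (cycleEdges c).map (Prod.map f f) := by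
  rw [cycleEdges, cycleEdges, ← pathEdges_map]
  cases c <;> simp

theorem pathEdges_append {l m : List ℤ} {x y : ℤ} (hl : l.getLast? = some x)
    (hm : m.head? = some y) :
    pathEdges (l ++ m) = pathEdges l + (x, y) ::ₘ pathEdges m := by
  induction l with
  | nil => simp at hl
  | cons a l ih =>
    cases l with
    | nil =>
      cases m with
      | nil => simp at hm
      | cons b m =>
        simp only [List.getLast?_singleton, Option.some.injEq, List.head?_cons] at hl hm
        subst hl hm
        simp [pathEdges]
    | cons b l =>
      rw [List.getLast?_cons_cons] at hl
      have := ih hl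
      simp only [List.cons_append, pathEdges] at this ⊢
      rw [this, Multiset.cons_add]

theorem pathEdges_reverse (l : List ℤ) :
    pathEdges l.reverse = (pathEdges l).map Prod.swap := by
  induction l with
  | nil => rfl
  | cons a l ih =>
    cases l with
    | nil => rfl
    | cons b l =>
      rw [List.reverse_cons, pathEdges_append (x := b) (y := a) (by simp) rfl, ih]
      simp [pathEdges]
      rw [← Multiset.singleton_add, add_comm, Multiset.singleton_add]

theorem cycleEdges_eq {c : List ℤ} {x y : ℤ} (hx : c.head? = some x) (hy : c.getLast? = some y) :
    cycleEdges c = pathEdges c + {(y, x)} := by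
  rw [cycleEdges, hx, Option.toList_some, pathEdges_append hy rfl]
  rfl

theorem labEdges_map (f : ℤ → ℤ) (l : List ℤ) (cs : List (List ℤ)) :
    labEdges (l.map f) (cs.map (List.map f)) = (labEdges l cs).map (Prod.map f f) := by
  rw [labEdges, labEdges, pathEdges_map, Multiset.map_add]
  congr 1
  induction cs with
  | nil => rfl
  | cons c cs ih => simp only [List.map_cons, List.sum_cons, ih, cycleEdges_map, Multiset.map_add]

theorem labVerts_map (f : ℤ → ℤ) (l : List ℤ) (cs : List (List ℤ)) :
    labVerts (l.map f) (cs.map (List.map f)) = (labVerts l cs).map f := by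
  simp [labVerts, List.map_flatten]

theorem labVerts_append (l m : List ℤ) (cs ds : List (List ℤ)) :
    labVerts (l ++ m) (cs ++ ds) = labVerts l cs + labVerts m ds := by
  simp only [labVerts, List.flatten_append, ← Multiset.coe_add]
  exact add_add_add_comm _ _ _ _

theorem labEdges_append {l m : List ℤ} (cs ds : List (List ℤ)) {x y : ℤ}
    (hl : l.getLast? = some x) (hm : m.head? = some y) :
    labEdges (l ++ m) (cs ++ ds) = (x, y) ::ₘ (labEdges l cs + labEdges m ds) := by
  simp only [labEdges, pathEdges_append hl hm, List.map_append, List.sum_append,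
    ← Multiset.singleton_add]
  abel

theorem pathEdges_range (g : ℕ → ℤ) (K : ℕ) :
    pathEdges ((List.range (K + 1)).map g) =
      (Multiset.range K).map (fun i => (g i, g (i + 1))) := by
  induction K with
  | zero => rfl
  | succ K ih =>
    rw [List.range_succ, List.map_append,
      pathEdges_append (x := g K) (y := g (K + 1)) (by simp [List.range_succ]) (by simp), ih,
      Multiset.range_succ, Multiset.map_cons]
    simp [pathEdges, ← Multiset.singleton_add, add_comm]

/-! ### Differences -/

theorem map_edgeDiff_swap (E : Multiset (ℤ × ℤ)) :
    (E.map Prod.swap).map edgeDiff = E.map edgeDiff := by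
  rw [Multiset.map_map]
  exact Multiset.map_congr rfl fun e _ => abs_sub_comm _ _

theorem map_edgeDiff_add (c : ℤ) (E : Multiset (ℤ × ℤ)) :
    (E.map (Prod.map (c + ·) (c + ·))).map edgeDiff = E.map edgeDiff := by
  rw [Multiset.map_map]
  refine Multiset.map_congr rfl fun e _ => ?_
  simp [edgeDiff]

theorem map_edgeDiff_mirror (c : ℤ) (E : Multiset (ℤ × ℤ)) :
    (E.map (Prod.map (c - ·) (c - ·))).map edgeDiff = E.map edgeDiff := by
  rw [Multiset.map_map]
  refine Multiset.map_congr rfl fun e _ => ?_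
  simp [edgeDiff, abs_sub_comm]

/-- A crossing edge has just its larger end at or above `p`, and only that end moves. -/
theorem map_edgeDiff_gap {p N : ℤ} (hN : 0 ≤ N) {E : Multiset (ℤ × ℤ)}
    (hE : ∀ e ∈ E, Crosses p e) :
    (E.map (Prod.map (gap p N) (gap p N))).map edgeDiff = (E.map edgeDiff).map (· + N) := by
  rw [Multiset.map_map, Multiset.map_map]
  refine Multiset.map_congr rfl fun e he => ?_
  have := hE e he
  obtain ⟨a, b⟩ := e
  simp only [Crosses, edgeDiff, Function.comp, Prod.map, gap] at this ⊢
  split_ifs <;> first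
    | omega
    | rw [abs_of_nonpos (by omega), abs_of_nonpos (by omega)]; omega
    | rw [abs_of_nonneg (by omega), abs_of_nonneg (by omega)]; omega

/-! ### Operations on labellings -/

theorem AlphaLab.congr {p n s t p' n' s' t' : ℤ} {L : List ℕ} (h : AlphaLab p n s t L)
    (hp : p = p') (hn : n = n') (hs : s = s') (ht : t = t') : AlphaLab p' n' s' t' L := by
  subst hp hn hs ht; exact h

theorem GoodLab.congr {n s n' s' : ℤ} {L : List ℕ} (h : GoodLab n s L)
    (hn : n = n') (hs : s = s') : GoodLab n' s' L := by
  subst hn hs; exact h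

theorem AlphaLab.good {p n s t : ℤ} {L : List ℕ} (h : AlphaLab p n s t L) : GoodLab n s L := by
  obtain ⟨l, cs, h1, h2, h3, h4, h5, -⟩ := h
  exact ⟨t, l, cs, h1, h2, h3, h4, h5, fun _ _ => trivial⟩

theorem HasLab.mirror {X Y : ℤ × ℤ → Prop} {n s t : ℤ} {L : List ℕ} (h : HasLab X n s t L)
    (hXY : ∀ e, X e → Y (n - 1 - e.1, n - 1 - e.2)) :
    HasLab Y n (n - 1 - s) (n - 1 - t) L := by
  obtain ⟨l, cs, h1, h2, h3, h4, h5, h6⟩ := h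
  refine ⟨l.map (n - 1 - ·), cs.map (List.map (n - 1 - ·)), by simp [h1], by simp [h2], ?_, ?_, ?_, ?_⟩
  · rw [← h3, List.map_map]; congr 1; ext; simp
  · rw [labVerts_map, h4, map_sub_Ico]
  · rw [labEdges_map, map_edgeDiff_mirror, h5]
  · rw [labEdges_map]
    intro e he
    obtain ⟨e', he', rfl⟩ := Multiset.mem_map.1 he
    exact hXY e' (h6 e' he')

theorem AlphaLab.mirror {p n s t : ℤ} {L : List ℕ} (h : AlphaLab p n s t L) :
    AlphaLab (n - p) n (n - 1 - s) (n - 1 - t) L := by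
  refine HasLab.mirror h fun e he => ?_
  simp only [Crosses] at he ⊢
  omega

theorem GoodLab.mirror {n s : ℤ} {L : List ℕ} (h : GoodLab n s L) : GoodLab n (n - 1 - s) L :=
  let ⟨t, h⟩ := h
  ⟨n - 1 - t, HasLab.mirror h fun _ _ => trivial⟩

theorem AlphaLab.reverse {p n s t : ℤ} {L : List ℕ} (h : AlphaLab p n s t L) :
    AlphaLab p n t s L := by
  obtain ⟨l, cs, h1, h2, h3, h4, h5, h6⟩ := h
  refine ⟨l.reverse, cs, by simp [h2], by simp [h1], h3, ?_, ?_, ?_⟩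
  · rw [← h4]; simp [labVerts]
  · rw [← h5]
    simp only [labEdges, Multiset.map_add, pathEdges_reverse, map_edgeDiff_swap]
  · intro e he
    rw [labEdges, pathEdges_reverse, Multiset.mem_add] at he
    rcases he with he | he
    · obtain ⟨e', he', rfl⟩ := Multiset.mem_map.1 he
      have := h6 e' (Multiset.mem_add.2 (Or.inl he'))
      simp only [Crosses, Prod.fst_swap, Prod.snd_swap] at this ⊢
      tauto
    · exact h6 e (Multiset.mem_add.2 (Or.inr he))

/-- Once the gap is open, the cut may be put anywhere inside it, in particular at the cut of an
inner labelling. -/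
theorem crosses_gap {p p' N : ℤ} (h0 : 0 ≤ p') (h1 : p' ≤ N) {e : ℤ × ℤ} (he : Crosses p e) :
    Crosses (p + p') (Prod.map (gap p N) (gap p N) e) := by
  simp only [Crosses, gap, Prod.map] at he ⊢
  split_ifs <;> omega

theorem nest_verts {V W : Multiset ℤ} {p n N : ℤ} (h0 : 0 ≤ p) (hn : p ≤ n) (hN : 0 ≤ N)
    (hV : V = Ico 0 n) (hW : W = Ico 0 N) :
    V.map (gap p N) + W.map (p + ·) = Ico 0 (n + N) := by
  rw [hV, hW, map_gap_Ico h0 hn, map_add_left_Ico]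
  apply eq_Ico_of_cover
  · simp only [Multiset.card_add, card_Ico_int]; omega
  · intro x h1 h2
    simp only [Multiset.mem_add, Multiset.mem_Ico]; omega

/-- The inner differences fill `1, …, N - 1`, the link is `N`, and the outer ones fill `N + 1, …, N
+ n - 1`. The edge conditions are parameters so that one proof serves inner labellings with and
without a cut. -/
theorem HasLab.nest {X Y : ℤ × ℤ → Prop} {p n s e N z t : ℤ} {L L' : List ℕ}
    (ho : AlphaLab p n s e L) (hi : HasLab X N z t L') (h0 : 0 ≤ p) (hn : p ≤ n) (hN : 0 < N)
    (hlink : |gap p N e - (p + z)| = N)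
    (hY1 : ∀ e, Crosses p e → Y (Prod.map (gap p N) (gap p N) e))
    (hY2 : ∀ e, X e → Y (Prod.map (p + ·) (p + ·) e))
    (hY3 : Y (gap p N e, p + z)) :
    HasLab Y (n + N) (gap p N s) (p + t) (L ++ L') := by
  obtain ⟨l, cs, h1, h2, h3, h4, h5, h6⟩ := ho
  obtain ⟨l', cs', h1', h2', h3', h4', h5', h6'⟩ := hi
  have hl : (l.map (gap p N)).getLast? = some (gap p N e) := by simp [h2]
  have hm : (l'.map (p + ·)).head? = some (p + z) := by simp [h1']
  have hne : l' ≠ [] := by rintro rfl; simp at h1'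
  refine ⟨l.map (gap p N) ++ l'.map (p + ·), cs.map (List.map (gap p N)) ++ cs'.map (List.map (p + ·)),
    by simp [h1], by simp [List.getLast?_append, h2'], ?_, ?_, ?_, ?_⟩
  · rw [List.map_append, List.map_map, List.map_map, ← h3, ← h3']
    congr 1 <;> (congr 1; ext; simp)
  · rw [labVerts_append, labVerts_map, labVerts_map]
    exact nest_verts h0 hn hN.le h4 h4'
  · rw [labEdges_append _ _ hl hm, labEdges_map, labEdges_map, Multiset.map_cons, Multiset.map_add,
      map_edgeDiff_add, map_edgeDiff_gap hN.le h6, h5, h5', map_add_Ico, edgeDiff, hlink]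
    apply eq_Ico_of_cover
    · have : 1 ≤ n ∨ n = 0 := by omega
      have hn1 : 1 ≤ n := by
        rcases this with h | rfl
        · exact h
        · exfalso
          have := congrArg Multiset.card h4
          rw [card_Ico_int, labVerts] at this
          cases l with
          | nil => simp at h1
          | cons a l => simp at this
      simp only [Multiset.card_cons, Multiset.card_add, card_Ico_int]; omega
    · intro x h1 h2
      simp only [Multiset.mem_cons, Multiset.mem_add, Multiset.mem_Ico]; omega
  · rw [labEdges_append _ _ hl hm, labEdges_map, labEdges_map]
    intro e he
    rcases Multiset.mem_cons.1 he with rfl | he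
    · exact hY3
    rcases Multiset.mem_add.1 he with he | he
    · obtain ⟨e', he', rfl⟩ := Multiset.mem_map.1 he
      exact hY1 e' (h6 e' he')
    · obtain ⟨e', he', rfl⟩ := Multiset.mem_map.1 he
      exact hY2 e' (h6' e' he')

theorem AlphaLab.nest {p n s e p' N z t : ℤ} {L L' : List ℕ}
    (ho : AlphaLab p n s e L) (hi : AlphaLab p' N z t L') (h0 : 0 ≤ p) (hn : p ≤ n) (hN : 0 < N)
    (hp0 : 0 ≤ p') (hp1 : p' ≤ N)
    (hlink : |gap p N e - (p + z)| = N) (hx : e < p ↔ ¬ z < p') :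
    AlphaLab (p + p') (n + N) (gap p N s) (p + t) (L ++ L') := by
  refine HasLab.nest ho hi h0 hn hN hlink (fun e he => crosses_gap hp0 hp1 he) (fun e he => ?_) ?_
  · simp only [Crosses, Prod.map] at he ⊢; omega
  · simp only [Crosses, gap]; split_ifs <;> omega

theorem AlphaLab.nest_good {p n s e N z : ℤ} {L L' : List ℕ}
    (ho : AlphaLab p n s e L) (hi : GoodLab N z L') (h0 : 0 ≤ p) (hn : p ≤ n) (hN : 0 < N)
    (hlink : |gap p N e - (p + z)| = N) :
    GoodLab (n + N) (gap p N s) (L ++ L') :=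
  let ⟨t, hi⟩ := hi
  ⟨p + t, HasLab.nest ho hi h0 hn hN hlink (fun _ _ => trivial) (fun _ _ => trivial) trivial⟩

theorem abs_sub_eq {a b c : ℤ} (hc : 0 ≤ c) (h : a - b = c ∨ b - a = c) : |a - b| = c := by
  rcases h with h | h
  · rw [h, abs_of_nonneg hc]
  · rw [abs_sub_comm, h, abs_of_nonneg hc]

/-! ### Labellings of paths -/

/-- The zigzag labelling `0, n - 1, 1, n - 2, …` -/
theorem alphaLab_zigzag {n : ℤ} (hn : 1 ≤ n) : AlphaLab ((n + 1) / 2) n 0 (n / 2) [] := by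
  obtain ⟨m, rfl⟩ : ∃ m : ℕ, n = m + 1 := ⟨(n - 1).toNat, by omega⟩
  let g : ℕ → ℤ := fun i => if i % 2 = 0 then i / 2 else m - i / 2
  refine ⟨(List.range (m + 1)).map g, [], ?_, ?_, rfl, ?_, ?_, ?_⟩
  · simp [List.range_succ_eq_map, g]
  · simp only [List.range_succ, List.map_append, List.map_cons, List.map_nil,
      List.getLast?_append, List.getLast?_singleton, Option.some_or, g]
    congr 1; split_ifs <;> omega
  · simp only [labVerts, List.flatten_nil, Multiset.coe_nil, add_zero]
    apply eq_Ico_of_cover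
    · simp
    · intro x h1 h2
      rw [Multiset.mem_coe, List.mem_map]
      simp only [List.mem_range, g]
      by_cases hx : 2 * x ≤ m
      · exact ⟨(2 * x).toNat, by omega, by split_ifs <;> omega⟩
      · exact ⟨(2 * (m - x) + 1).toNat, by omega, by split_ifs <;> omega⟩
  · rw [labEdges, pathEdges_range, List.map_nil, List.sum_nil, add_zero, Multiset.map_map]
    apply eq_Ico_of_cover
    · simp
    · intro x h1 h2
      rw [Multiset.mem_map]
      refine ⟨(m - x).toNat, by rw [Multiset.mem_range]; omega, abs_sub_eq (by omega) ?_⟩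
      simp only [g]
      split_ifs <;> omega
  · rw [labEdges, pathEdges_range, List.map_nil, List.sum_nil, add_zero]
    intro e he
    obtain ⟨i, hi, rfl⟩ := Multiset.mem_map.1 he
    rw [Multiset.mem_range] at hi
    simp only [Crosses, g]
    split_ifs <;> omega

/-- The zigzag labelling `n - 1, 0, n - 2, 1, …` -/
theorem alphaLab_zigzag_mirror {n : ℤ} (hn : 1 ≤ n) :
    AlphaLab (n / 2) n (n - 1) (n - 1 - n / 2) [] :=
  (alphaLab_zigzag hn).mirror.congr (by omega) rfl (by omega) rfl

theorem gap_of_lt {p N x : ℤ} (h : x < p) : gap p N x = x := if_pos h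

theorem gap_of_le {p N x : ℤ} (h : p ≤ x) : gap p N x = x + N := if_neg (not_lt.2 h)

/-- A path on an even number of vertices with one end in each half, at distance `p`. -/
theorem alphaLab_even_path {p a : ℤ} (ha : 0 ≤ a) (hap : a < p) :
    AlphaLab p (2 * p) a (a + p) [] := by
  obtain ⟨m, hm⟩ : ∃ m : ℕ, p ≤ m := ⟨p.toNat, by omega⟩
  induction m generalizing p a with
  | zero => omega
  | succ m ih =>
    have key : ∀ a, 0 ≤ a → 2 * a ≤ p - 1 → AlphaLab p (2 * p) a (a + p) [] := by
      intro a ha hap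
      rcases hap.lt_or_eq with h | h
      -- Peel off a zigzag on `2a + 2` labels from `a` to `2a + 1`; inside remains the same problem
      -- with `p - a - 1` in place of `p` and the same `a`.
      · refine (((alphaLab_zigzag_mirror (n := 2 * a + 2) (by omega)).reverse).nest
          (ih (p := p - a - 1) (a := a) ha (by omega) (by omega)) (by omega) (by omega) (by omega)
          (by omega) (by omega) ?_ (by omega)).congr (by omega) (by omega) ?_ (by omega)
        · rw [gap_of_le (by omega)]; exact abs_sub_eq (by omega) (by omega)
        · rw [gap_of_lt (by omega)]; omega
      -- In the balanced case `p = 2a + 1`, two zigzags on `p` labels suffice.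
      · refine (((alphaLab_zigzag (n := 2 * a + 1) (by omega)).reverse).nest
          (alphaLab_zigzag_mirror (n := 2 * a + 1) (by omega)).reverse (by omega) (by omega)
          (by omega) (by omega) (by omega) ?_ (by omega)).congr (by omega) (by omega) ?_ (by omega)
        · rw [gap_of_lt (by omega)]; exact abs_sub_eq (by omega) (by omega)
        · rw [gap_of_lt (by omega)]; omega
    by_cases h : 2 * a ≤ p - 1
    · exact key a ha h
    · exact (key (p - 1 - a) (by omega) (by omega)).mirror.reverse.congr
        (by omega) rfl (by omega) (by omega)

/-- A path on an odd number of vertices with both ends in the lower half. -/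
theorem alphaLab_odd_path {q a : ℤ} (ha : 0 ≤ a) (haq : 2 * a < q) :
    AlphaLab (q + 1) (2 * q + 1) a (q - a) [] := by
  refine (((alphaLab_zigzag (n := 2 * a + 1) (by omega)).reverse).nest
    (alphaLab_even_path (p := q - a) (a := q - 2 * a - 1) (by omega) (by omega)).reverse (by omega)
    (by omega) (by omega) (by omega) (by omega) ?_ (by omega)).congr
    (by omega) (by omega) ?_ (by omega)
  · rw [gap_of_lt (by omega)]; exact abs_sub_eq (by omega) (by omega)
  · rw [gap_of_lt (by omega)]; omega

/-- The second end of the paths starting at `1` used below. -/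
def pathEnd (n : ℤ) : ℤ := if n % 2 = 0 then n / 2 + 1 else n / 2 - 1

/-- The end `1`, or its mirror image, is what the inner end of the zigzag gadget below links to. For
`M = 5` the two prescribed ends would coincide. -/
theorem alphaLab_path_one {M : ℤ} (h3 : 3 ≤ M) (h5 : M ≠ 5) :
    AlphaLab ((M + 1) / 2) M 1 (pathEnd M) [] := by
  rcases Int.even_or_odd' M with ⟨q, rfl | rfl⟩
  · exact (alphaLab_even_path (p := q) (a := 1) (by omega) (by omega)).congr (by omega) rfl rfl
      (by rw [pathEnd, if_pos (by omega)]; omega)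
  · by_cases hq : 2 < q
    · exact (alphaLab_odd_path (q := q) (a := 1) (by omega) (by omega)).congr (by omega) rfl rfl
        (by rw [pathEnd, if_neg (by omega)]; omega)
    · obtain rfl : q = 1 := by omega
      exact (alphaLab_odd_path (q := 1) (a := 0) (by omega) (by omega)).reverse.congr (by omega) rfl
        rfl (by rw [pathEnd, if_neg (by omega)]; omega)

/-! ### Enlarging the path -/

/-- A path wrapped around the mirrored labelling brings the free end back to `d`, so the path grows
while its end stays put. -/
theorem GoodLab.enlarge_even {N d p : ℤ} {L : List ℕ} (h : GoodLab N d L) (hd : 0 ≤ d)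
    (hN : d < N) (hp : d + 1 ≤ p) : GoodLab (N + 2 * p) d L := by
  have := (alphaLab_even_path (p := p) (a := p - 1 - d) (by omega) (by omega)).reverse.nest_good
    h.mirror (by omega) (by omega) (by omega) ?_
  · refine this.mirror.congr (by omega) ?_
    rw [gap_of_le (by omega)]; omega
  · rw [gap_of_lt (by omega)]; exact abs_sub_eq (by omega) (by omega)

theorem GoodLab.enlarge_odd {N d q : ℤ} {L : List ℕ} (h : GoodLab N d L) (hd : 0 ≤ d)
    (hN : d < N) (hq : d ≤ q) (hqd : q ≠ 2 * d) : GoodLab (N + (2 * q + 1)) d L := by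
  have key : AlphaLab (q + 1) (2 * q + 1) d (q - d) [] := by
    by_cases h2 : 2 * d < q
    · exact alphaLab_odd_path hd h2
    · exact (alphaLab_odd_path (q := q) (a := q - d) (by omega) (by omega)).reverse.congr rfl rfl
        (by omega) rfl
  have := key.nest_good h.mirror (by omega) (by omega) (by omega) ?_
  · refine this.congr (by omega) ?_
    rw [gap_of_lt (by omega)]
  · rw [gap_of_lt (by omega)]; exact abs_sub_eq (by omega) (by omega)

/-- The largest increment that can fail is `4d + 1`, the excluded case `q = 2d`, where the two ends
of the wrapped path would coincide. -/
theorem GoodLab.enlarge {N d n : ℤ} {L : List ℕ} (h : GoodLab N d L) (hd : 0 ≤ d)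
    (hN : d < N) (hn : N + 4 * d + 2 ≤ n) : GoodLab n d L := by
  rcases Int.even_or_odd' (n - N) with ⟨p, hp | hp⟩
  · exact (h.enlarge_even hd hN (p := p) (by omega)).congr (by omega) rfl
  · exact (h.enlarge_odd hd hN (q := p) (by omega) (by omega)).congr (by omega) rfl

/-! ### Three interleaved zigzags -/

/-- The first of three interleaved zigzags on `3 * k + 5` labels. -/
def strandA (k i : ℕ) : ℤ := if i % 2 = 0 then 3 * i / 2 + 1 else 3 * k + 4 - (3 * i + 1) / 2

/-- The second of three interleaved zigzags on `3 * k + 5` labels. -/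
def strandB (k i : ℕ) : ℤ := if i % 2 = 0 then 3 * i / 2 + 2 else 3 * k + 4 - (3 * i + 3) / 2

/-- The third of three interleaved zigzags on `3 * k + 5` labels. -/
def strandC (k i : ℕ) : ℤ := if i % 2 = 0 then 3 * k + 4 - (3 * i / 2 + 1) else (3 * i + 3) / 2

/-- The path along the first zigzag. -/
def pathA (k : ℕ) : List ℤ := (List.range (k + 1)).map (strandA k)

/-- The path along the second zigzag and back along the third. -/
def pathBC (k : ℕ) : List ℤ :=
  (List.range (k + 1)).map (strandB k) ++ ((List.range (k + 1)).map (strandC k)).reverse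

theorem head?_map_range (g : ℕ → ℤ) (k : ℕ) : ((List.range (k + 1)).map g).head? = some (g 0) := by
  simp [List.range_succ_eq_map]

theorem getLast?_map_range (g : ℕ → ℤ) (k : ℕ) :
    ((List.range (k + 1)).map g).getLast? = some (g k) := by
  simp [List.range_succ]

theorem pathA_head (k : ℕ) : (pathA k).head? = some 1 := by
  rw [pathA, head?_map_range]; simp [strandA]

theorem pathA_last (k : ℕ) : (pathA k).getLast? = some (strandA k k) := by
  rw [pathA, getLast?_map_range]

theorem pathBC_head (k : ℕ) : (pathBC k).head? = some 2 := by
  rw [pathBC, List.head?_append, head?_map_range]; simp [strandB]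

theorem pathBC_last (k : ℕ) : (pathBC k).getLast? = some (3 * k + 3 : ℤ) := by
  rw [pathBC, List.getLast?_append, List.getLast?_reverse, head?_map_range]
  simp [strandC]; ring

theorem pathBC_length (k : ℕ) : (pathBC k).length = 2 * k + 2 := by
  simp [pathBC]; ring

theorem pathBC_edges (k : ℕ) : pathEdges (pathBC k) =
    (Multiset.range k).map (fun i => (strandB k i, strandB k (i + 1))) +
      (strandB k k, strandC k k) ::ₘ
        (Multiset.range k).map (fun i => (strandC k (i + 1), strandC k i)) := by
  rw [pathBC, pathEdges_append (getLast?_map_range _ _)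
    (by rw [List.head?_reverse, getLast?_map_range]), pathEdges_reverse, pathEdges_range,
    pathEdges_range, Multiset.map_map]
  rfl

theorem strand_verts (k : ℕ) :
    (0 : ℤ) ::ₘ (3 * k + 4 : ℤ) ::ₘ ((pathA k : Multiset ℤ) + (pathBC k : List ℤ)) =
      Ico 0 (3 * k + 5 : ℤ) := by
  apply eq_Ico_of_cover
  · simp [pathA, pathBC]; omega
  · intro x h1 h2
    simp only [Multiset.mem_cons, Multiset.mem_add, Multiset.mem_coe, pathA, pathBC,
      List.mem_append, List.mem_reverse, List.mem_map, List.mem_range]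
    by_cases h0 : x = 0
    · exact Or.inl h0
    by_cases hl : x = 3 * k + 4
    · exact Or.inr (Or.inl hl)
    refine Or.inr (Or.inr ?_)
    simp only [strandA, strandB, strandC]
    -- In the lower half, the residue of `x` modulo `3` selects the strand; in the upper half, that
    -- of its mirror image does, with the strands in another order.
    by_cases hx : 2 * x < 3 * k + 5
    · obtain ⟨q, hq | hq | hq⟩ : ∃ q, x = 3 * q + 1 ∨ x = 3 * q + 2 ∨ x = 3 * q + 3 :=
        ⟨(x - 1) / 3, by omega⟩
      · exact Or.inl ⟨(2 * q).toNat, by omega, by split_ifs <;> omega⟩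
      · exact Or.inr (Or.inl ⟨(2 * q).toNat, by omega, by split_ifs <;> omega⟩)
      · exact Or.inr (Or.inr ⟨(2 * q + 1).toNat, by omega, by split_ifs <;> omega⟩)
    · obtain ⟨q, hq | hq | hq⟩ : ∃ q, 3 * k + 4 - x = 3 * q + 1 ∨ 3 * k + 4 - x = 3 * q + 2 ∨
          3 * k + 4 - x = 3 * q + 3 := ⟨(3 * k + 4 - x - 1) / 3, by omega⟩
      · exact Or.inr (Or.inr ⟨(2 * q).toNat, by omega, by split_ifs <;> omega⟩)
      · exact Or.inl ⟨(2 * q + 1).toNat, by omega, by split_ifs <;> omega⟩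
      · exact Or.inr (Or.inl ⟨(2 * q + 1).toNat, by omega, by split_ifs <;> omega⟩)

/-- Along each strand the differences fall by `3`: from `3k + 1` on the first, `3k - 1` on the
second and `3k` on the third. They use the three residue classes down to `2`; the edge joining the
last two strands has difference `1`. -/
theorem strand_diffs (k : ℕ) :
    (pathEdges (pathA k) + pathEdges (pathBC k)).map edgeDiff = Ico 1 (3 * k + 2 : ℤ) := by
  rw [pathA, pathEdges_range, pathBC_edges]
  simp only [Multiset.map_add, Multiset.map_cons, Multiset.map_map]
  apply eq_Ico_of_cover
  · simp; omega
  · intro x h1 h2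
    simp only [Multiset.mem_add, Multiset.mem_cons, Multiset.mem_map, Multiset.mem_range,
      Function.comp, edgeDiff]
    by_cases hl : x = 1
    · refine Or.inr (Or.inr (Or.inl (Eq.symm (abs_sub_eq (by omega) ?_))))
      simp only [strandB, strandC]
      split_ifs <;> omega
    obtain ⟨q, hq | hq | hq⟩ : ∃ q, 3 * k + 4 - x = 3 * q + 3 ∨ 3 * k + 4 - x = 3 * q + 4 ∨
        3 * k + 4 - x = 3 * q + 5 := ⟨(3 * k + 4 - x - 3) / 3, by omega⟩
    · refine Or.inl ⟨q.toNat, by omega, abs_sub_eq (by omega) ?_⟩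
      simp only [strandA]
      split_ifs <;> omega
    · refine Or.inr (Or.inr (Or.inr ⟨q.toNat, by omega, abs_sub_eq (by omega) ?_⟩))
      simp only [strandC]
      split_ifs <;> omega
    · refine Or.inr (Or.inl ⟨q.toNat, by omega, abs_sub_eq (by omega) ?_⟩)
      simp only [strandB]
      split_ifs <;> omega

theorem strand_crosses (k : ℕ) :
    ∀ e ∈ pathEdges (pathA k) + pathEdges (pathBC k), Crosses ((3 * k + 6) / 2) e := by
  rw [pathA, pathEdges_range, pathBC_edges]
  intro e he
  simp only [Multiset.mem_add, Multiset.mem_cons, Multiset.mem_map, Multiset.mem_range] at he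
  rcases he with ⟨i, hi, rfl⟩ | ⟨i, hi, rfl⟩ | rfl | ⟨i, hi, rfl⟩
  all_goals
    simp only [Crosses, strandA, strandB, strandC]
    split_ifs <;> omega

/-- A path, and a cycle of length `2 * k + 4`, through three interleaved zigzags. -/
theorem alphaLab_even_cycle (k : ℕ) :
    AlphaLab ((3 * k + 6) / 2) (3 * k + 5) 1 (strandA k k) [2 * k + 4] := by
  have hcyc : cycleEdges (0 :: (3 * k + 4 : ℤ) :: pathBC k) =
      (0, (3 * k + 4 : ℤ)) ::ₘ ((3 * k + 4 : ℤ), 2) ::ₘ ((3 * k + 3 : ℤ), 0) ::ₘ pathEdges (pathBC k) := by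
    rw [cycleEdges_eq (x := 0) (y := 3 * k + 3) rfl
      (by simp only [List.getLast?_cons, pathBC_last, Option.getD_some])]
    have h : pathEdges ((3 * k + 4 : ℤ) :: pathBC k) = ((3 * k + 4 : ℤ), 2) ::ₘ pathEdges (pathBC k) := by
      have := pathEdges_append (l := [(3 * k + 4 : ℤ)]) rfl (pathBC_head k)
      simpa [pathEdges] using this
    rw [pathEdges, h]
    simp only [← Multiset.singleton_add]
    abel
  have hlab : labEdges (pathA k) [0 :: (3 * k + 4 : ℤ) :: pathBC k] =
      (0, (3 * k + 4 : ℤ)) ::ₘ ((3 * k + 4 : ℤ), 2) ::ₘ ((3 * k + 3 : ℤ), 0) ::ₘ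
        (pathEdges (pathA k) + pathEdges (pathBC k)) := by
    rw [labEdges, List.map_singleton, List.sum_singleton, hcyc]
    simp only [← Multiset.singleton_add]
    abel
  refine ⟨pathA k, [0 :: (3 * k + 4 : ℤ) :: pathBC k], pathA_head k, pathA_last k, ?_, ?_, ?_, ?_⟩
  · simp [pathBC_length]
  · rw [← strand_verts]
    simp only [labVerts, List.flatten_singleton, ← Multiset.cons_coe, ← Multiset.singleton_add]
    abel
  · rw [hlab]
    simp only [Multiset.map_cons, strand_diffs, edgeDiff]
    -- The unused labels `0` and `3k + 4` close the cycle with precisely the three largest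
    -- differences.
    rw [abs_sub_eq (c := 3 * k + 4) (by omega) (by omega),
      abs_sub_eq (c := 3 * k + 2) (by omega) (by omega),
      abs_sub_eq (c := 3 * k + 3) (by omega) (by omega)]
    apply eq_Ico_of_cover
    · simp only [Multiset.card_cons, card_Ico_int]; omega
    · intro x h1 h2
      simp only [Multiset.mem_cons, Multiset.mem_Ico]; omega
  · rw [hlab]
    intro e he
    rcases Multiset.mem_cons.1 he with rfl | he
    · simp only [Crosses]; omega
    rcases Multiset.mem_cons.1 he with rfl | he
    · simp only [Crosses]; omega
    rcases Multiset.mem_cons.1 he with rfl | he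
    · simp only [Crosses]; omega
    exact strand_crosses k e he

/-- The shape (cut, end `1`, end `pathEnd`) reproduces itself, so even cycles can be inserted one
after another. The parity of `k` decides on which side of the cut the strand ends, hence whether the
inner labelling is mirrored. -/
theorem AlphaLab.insert_even {N : ℤ} {L : List ℕ} (k : ℕ) (hN : 3 ≤ N)
    (h : AlphaLab ((N + 1) / 2) N 1 (pathEnd N) L) :
    AlphaLab ((N + (3 * k + 5) + 1) / 2) (N + (3 * k + 5)) 1 (pathEnd (N + (3 * k + 5)))
      ((2 * k + 4) :: L) := by
  rcases Nat.even_or_odd' k with ⟨j, rfl | rfl⟩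
  · refine ((alphaLab_even_cycle (2 * j)).nest h.mirror (by omega) (by omega) (by omega) (by omega)
      (by omega) ?_ ?_).congr (by omega) (by omega) ?_ ?_
    · rw [strandA, if_pos (by omega), gap_of_lt (by omega)]
      exact abs_sub_eq (by omega) (by omega)
    · rw [strandA, if_pos (by omega)]; omega
    · rw [gap_of_lt (by omega)]
    · simp only [pathEnd]; split_ifs <;> omega
  · refine ((alphaLab_even_cycle (2 * j + 1)).nest h (by omega) (by omega) (by omega) (by omega)
      (by omega) ?_ ?_).congr (by omega) (by omega) ?_ ?_
    · rw [strandA, if_neg (by omega), gap_of_le (by omega)]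
      exact abs_sub_eq (by omega) (by omega)
    · rw [strandA, if_neg (by omega)]; omega
    · rw [gap_of_lt (by omega)]
    · simp only [pathEnd]; split_ifs <;> omega

/-- The least number of vertices used by even cycles of lengths `2 * k + 4`, `k ∈ ks`. -/
def evenSize (ks : List ℕ) : ℕ := (ks.map fun k => 3 * k + 5).sum

/-- Even cycles of length `2 * k + 4`, for the members `k` of a list, and a path. -/
theorem alphaLab_even_cycles {M : ℤ} (h3 : 3 ≤ M) (h5 : M ≠ 5) (ks : List ℕ) :
    AlphaLab ((M + evenSize ks + 1) / 2) (M + evenSize ks) 1 (pathEnd (M + evenSize ks))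
      (ks.map fun k => 2 * k + 4) := by
  induction ks with
  | nil => simpa [evenSize] using alphaLab_path_one h3 h5
  | cons k ks ih =>
    have hs : M + (evenSize (k :: ks) : ℤ) = M + evenSize ks + (3 * k + 5) := by
      simp [evenSize]; ring
    rw [List.map_cons, hs]
    exact ih.insert_even k (by omega)

/-! ### Labellings with an open strand -/

/-- There is a labelling of a path with ends `s` and `t` and a disjoint path on `m` vertices with
ends `b` and `w`, all edges of which cross `p`, with every difference but `d` occurring. -/
def OpenLab (p n s t b w : ℤ) (m : ℕ) (d : ℤ) : Prop :=
  ∃ l q : List ℤ, l.head? = some s ∧ l.getLast? = some t ∧ q.head? = some b ∧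
    q.getLast? = some w ∧ q.length = m ∧ (l : Multiset ℤ) + (q : Multiset ℤ) = Ico 0 n ∧
    d ::ₘ (pathEdges l + pathEdges q).map edgeDiff = Ico 1 n ∧
    ∀ e ∈ pathEdges l + pathEdges q, Crosses p e

theorem OpenLab.congr {p n s t b w d p' n' s' t' b' w' d' : ℤ} {m : ℕ}
    (h : OpenLab p n s t b w m d) (hp : p = p') (hn : n = n') (hs : s = s') (ht : t = t')
    (hb : b = b') (hw : w = w') (hd : d = d') : OpenLab p' n' s' t' b' w' m d' := by
  subst hp hn hs ht hb hw hd; exact h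

/-- The labels `0` and `3k + 4` now prolong the path instead of closing the cycle. This costs one
edge, of difference `3k + 2`, and leaves the strand open for an odd cycle. -/
theorem openLab_strands (k : ℕ) :
    OpenLab ((3 * k + 6) / 2) (3 * k + 5) 0 (strandA k k) 2 (3 * k + 3) (2 * k + 2) (3 * k + 2) := by
  have hE : pathEdges (0 :: (3 * k + 4 : ℤ) :: pathA k) =
      (0, (3 * k + 4 : ℤ)) ::ₘ ((3 * k + 4 : ℤ), 1) ::ₘ pathEdges (pathA k) := by
    have := pathEdges_append (l := [(3 * k + 4 : ℤ)]) rfl (pathA_head k)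
    rw [pathEdges]
    simpa [pathEdges] using this
  refine ⟨0 :: (3 * k + 4 : ℤ) :: pathA k, pathBC k, rfl, ?_, pathBC_head k, pathBC_last k,
    pathBC_length k, ?_, ?_, ?_⟩
  · simp only [List.getLast?_cons, pathA_last, Option.getD_some]
  · rw [← strand_verts]; simp
  · rw [hE, Multiset.cons_add, Multiset.cons_add]
    simp only [Multiset.map_cons, strand_diffs, edgeDiff]
    rw [abs_sub_eq (c := 3 * k + 4) (by omega) (by omega),
      abs_sub_eq (c := 3 * k + 3) (by omega) (by omega)]
    apply eq_Ico_of_cover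
    · simp only [Multiset.card_cons, card_Ico_int]; omega
    · intro x h1 h2
      simp only [Multiset.mem_cons, Multiset.mem_Ico]; omega
  · rw [hE, Multiset.cons_add, Multiset.cons_add]
    intro e he
    rcases Multiset.mem_cons.1 he with rfl | he
    · simp only [Crosses]; omega
    rcases Multiset.mem_cons.1 he with rfl | he
    · simp only [Crosses]; omega
    exact strand_crosses k e he

theorem AlphaLab.exists_path {p n s t : ℤ} (h : AlphaLab p n s t []) :
    ∃ l : List ℤ, l.head? = some s ∧ l.getLast? = some t ∧ (l : Multiset ℤ) = Ico 0 n ∧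
      (pathEdges l).map edgeDiff = Ico 1 n ∧ ∀ e ∈ pathEdges l, Crosses p e := by
  obtain ⟨l, cs, h1, h2, h3, h4, h5, h6⟩ := h
  obtain rfl : cs = [] := by simpa using h3
  simp only [labVerts, labEdges, List.flatten_nil, Multiset.coe_nil, add_zero, List.map_nil,
    List.sum_nil] at h4 h5 h6
  exact ⟨l, h1, h2, h4, h5, h6⟩

theorem map_crosses_gap {p p' N : ℤ} (h0 : 0 ≤ p') (h1 : p' ≤ N) {E : Multiset (ℤ × ℤ)}
    (hE : ∀ e ∈ E, Crosses p e) :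
    ∀ e ∈ E.map (Prod.map (gap p N) (gap p N)), Crosses (p + p') e := by
  intro e he
  obtain ⟨e', he', rfl⟩ := Multiset.mem_map.1 he
  exact crosses_gap h0 h1 (hE e' he')

theorem map_crosses_add {p p' : ℤ} {E : Multiset (ℤ × ℤ)} (hE : ∀ e ∈ E, Crosses p' e) :
    ∀ e ∈ E.map (Prod.map (p + ·) (p + ·)), Crosses (p + p') e := by
  intro e he
  obtain ⟨e', he', rfl⟩ := Multiset.mem_map.1 he
  have := hE e' he'
  simp only [Crosses, Prod.map] at this ⊢; omega

theorem OpenLab.nest {p n s e b w d p' N z t : ℤ} {m : ℕ} (ho : OpenLab p n s e b w m d)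
    (hi : AlphaLab p' N z t []) (h0 : 0 ≤ p) (hn : p ≤ n) (hn1 : 1 ≤ n) (hN : 0 < N) (hp0 : 0 ≤ p')
    (hp1 : p' ≤ N) (hlink : |gap p N e - (p + z)| = N) (hx : e < p ↔ ¬ z < p') :
    OpenLab (p + p') (n + N) (gap p N s) (p + t) (gap p N b) (gap p N w) m (d + N) := by
  obtain ⟨l, q, h1, h2, h3, h4, h5, h6, h7, h8⟩ := ho
  obtain ⟨l', k1, k2, k3, k4, k5⟩ := hi.exists_path
  have hE : pathEdges (l.map (gap p N) ++ l'.map (p + ·)) + pathEdges (q.map (gap p N)) =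
      (gap p N e, p + z) ::ₘ ((pathEdges l + pathEdges q).map (Prod.map (gap p N) (gap p N)) +
        (pathEdges l').map (Prod.map (p + ·) (p + ·))) := by
    rw [pathEdges_append (x := gap p N e) (y := p + z) (by simp [h2]) (by simp [k1])]
    simp only [pathEdges_map, Multiset.map_add, ← Multiset.singleton_add]
    abel
  refine ⟨l.map (gap p N) ++ l'.map (p + ·), q.map (gap p N), by simp [h1],
    by simp [List.getLast?_append, k2], by simp [h3], by simp [h4], by simp [h5], ?_, ?_, ?_⟩
  · rw [← nest_verts h0 hn hN.le h6 k3]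
    simp only [← Multiset.coe_add, ← Multiset.map_coe, Multiset.map_add]
    abel
  · have h7' := congrArg (Multiset.map (· + N)) h7
    rw [Multiset.map_cons, map_add_Ico] at h7'
    rw [hE, Multiset.map_cons, Multiset.map_add, map_edgeDiff_add, map_edgeDiff_gap hN.le h8, k4,
      Multiset.cons_swap, ← Multiset.cons_add, h7', edgeDiff, hlink]
    apply eq_Ico_of_cover
    · simp only [Multiset.card_cons, Multiset.card_add, card_Ico_int]; omega
    · intro x h1 h2
      simp only [Multiset.mem_cons, Multiset.mem_add, Multiset.mem_Ico]; omega
  · rw [hE]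
    intro f hf
    rcases Multiset.mem_cons.1 hf with rfl | hf
    · simp only [Crosses, gap]; split_ifs <;> omega
    rcases Multiset.mem_add.1 hf with hf | hf
    · exact map_crosses_gap hp0 hp1 h8 f hf
    · exact map_crosses_add k5 f hf

theorem AlphaLab.nest_open {p n s e p' N z t b w d : ℤ} {m : ℕ} (ho : AlphaLab p n s e [])
    (hi : OpenLab p' N z t b w m d) (h0 : 0 ≤ p) (hn : p ≤ n) (hn1 : 1 ≤ n) (hN : 0 < N)
    (hp0 : 0 ≤ p') (hp1 : p' ≤ N) (hlink : |gap p N e - (p + z)| = N) (hx : e < p ↔ ¬ z < p') :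
    OpenLab (p + p') (n + N) (gap p N s) (p + t) (p + b) (p + w) m d := by
  obtain ⟨l, k1, k2, k3, k4, k5⟩ := ho.exists_path
  obtain ⟨l', q, h1, h2, h3, h4, h5, h6, h7, h8⟩ := hi
  have hE : pathEdges (l.map (gap p N) ++ l'.map (p + ·)) + pathEdges (q.map (p + ·)) =
      (gap p N e, p + z) ::ₘ ((pathEdges l).map (Prod.map (gap p N) (gap p N)) +
        (pathEdges l' + pathEdges q).map (Prod.map (p + ·) (p + ·))) := by
    rw [pathEdges_append (x := gap p N e) (y := p + z) (by simp [k2]) (by simp [h1])]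
    simp only [pathEdges_map, Multiset.map_add, ← Multiset.singleton_add]
    abel
  refine ⟨l.map (gap p N) ++ l'.map (p + ·), q.map (p + ·), by simp [k1],
    by simp [List.getLast?_append, h2], by simp [h3], by simp [h4], by simp [h5], ?_, ?_, ?_⟩
  · rw [← nest_verts h0 hn hN.le k3 h6]
    simp only [← Multiset.coe_add, ← Multiset.map_coe, Multiset.map_add]
    abel
  · rw [hE, Multiset.map_cons, Multiset.map_add, map_edgeDiff_add, map_edgeDiff_gap hN.le k5, k4,
      Multiset.cons_swap, ← Multiset.add_cons, h7, map_add_Ico, edgeDiff, hlink]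
    apply eq_Ico_of_cover
    · simp only [Multiset.card_cons, Multiset.card_add, card_Ico_int]; omega
    · intro x h1 h2
      simp only [Multiset.mem_cons, Multiset.mem_add, Multiset.mem_Ico]; omega
  · rw [hE]
    intro f hf
    rcases Multiset.mem_cons.1 hf with rfl | hf
    · simp only [Crosses, gap]; split_ifs <;> omega
    rcases Multiset.mem_add.1 hf with hf | hf
    · exact map_crosses_gap hp0 hp1 k5 f hf
    · exact map_crosses_add h8 f hf

/-- The open gadget around a path. -/
theorem openLab_path {M : ℤ} (k : ℕ) (h3 : 3 ≤ M) (h5 : M ≠ 5) :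
    OpenLab ((M + (3 * k + 5) + 1) / 2) (M + (3 * k + 5)) 0 (pathEnd (M + (3 * k + 5))) 2
      (M + (3 * k + 3)) (2 * k + 2) (M + (3 * k + 2)) := by
  have h := alphaLab_path_one h3 h5
  rcases Nat.even_or_odd' k with ⟨j, rfl | rfl⟩
  · refine ((openLab_strands (2 * j)).nest h.mirror (by omega) (by omega) (by omega) (by omega)
      (by omega) (by omega) ?_ ?_).congr (by omega) (by omega) ?_ ?_ ?_ ?_ (by omega)
    · rw [strandA, if_pos (by omega), gap_of_lt (by omega)]
      exact abs_sub_eq (by omega) (by omega)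
    · rw [strandA, if_pos (by omega)]; omega
    · rw [gap_of_lt (by omega)]
    · simp only [pathEnd]; split_ifs <;> omega
    · rw [gap_of_lt (by omega)]
    · rw [gap_of_le (by omega)]; omega
  · refine ((openLab_strands (2 * j + 1)).nest h (by omega) (by omega) (by omega) (by omega)
      (by omega) (by omega) ?_ ?_).congr (by omega) (by omega) ?_ ?_ ?_ ?_ (by omega)
    · rw [strandA, if_neg (by omega), gap_of_le (by omega)]
      exact abs_sub_eq (by omega) (by omega)
    · rw [strandA, if_neg (by omega)]; omega
    · rw [gap_of_lt (by omega)]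
    · simp only [pathEnd]; split_ifs <;> omega
    · rw [gap_of_lt (by omega)]
    · rw [gap_of_le (by omega)]; omega

/-- A path on an even number of vertices next to an open strand. -/
theorem openLab_zigzag {N : ℤ} (k : ℕ) (hN : N % 2 = 0) (h3 : 3 * k + 4 ≤ N)
    (h5 : N ≠ 3 * k + 6) :
    OpenLab (N + 2) (2 * N + 4) 0 (N + 3) (N / 2 + 2) (3 * (N / 2) + 2) (2 * k + 2) (N + 1) := by
  refine ((alphaLab_zigzag (n := N) (by omega)).nest_open
    -- This `M` makes the inner size `N + 4`, so the ends and the missing difference depend on `N`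
    -- alone and not on `k`. The requirements `3 ≤ M` and `M ≠ 5` are the hypotheses on `N`.
    (openLab_path (M := N - 1 - 3 * k) k (by omega) (by omega)) (by omega) (by omega)
    (by omega) (by omega) (by omega) (by omega) ?_ ?_).congr (by omega) (by omega) ?_ ?_ ?_ ?_ ?_
  · rw [gap_of_le (by omega)]; exact abs_sub_eq (by omega) (by omega)
  · omega
  · rw [gap_of_lt (by omega)]
  · rw [pathEnd, if_pos (by omega)]; omega
  all_goals omega

/-! ### Inserting an odd cycle -/

theorem labEdges_cons (l c : List ℤ) (cs : List (List ℤ)) :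
    labEdges l (c :: cs) = cycleEdges c + labEdges l cs := by
  simp only [labEdges, List.map_cons, List.sum_cons]; abel

theorem labVerts_cons (l c : List ℤ) (cs : List (List ℤ)) :
    labVerts l (c :: cs) = (c : Multiset ℤ) + labVerts l cs := by
  simp only [labVerts, List.flatten_cons, ← Multiset.coe_add]; abel

theorem labEdges_append_left {l m : List ℤ} (cs : List (List ℤ)) {x y : ℤ}
    (hl : l.getLast? = some x) (hm : m.head? = some y) :
    labEdges (l ++ m) cs = (x, y) ::ₘ (pathEdges l + labEdges m cs) := by
  have := labEdges_append [] cs hl hm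
  simpa [labEdges] using this

theorem labVerts_append_left (l m : List ℤ) (cs : List (List ℤ)) :
    labVerts (l ++ m) cs = (l : Multiset ℤ) + labVerts m cs := by
  simp [labVerts]

theorem edgeDiff_mk (a b : ℤ) : edgeDiff (a, b) = |a - b| := rfl

theorem map_gap_add_edgeDiff {p N a : ℤ} (hN : 0 ≤ N) {l : List ℤ}
    (hE : ∀ e ∈ pathEdges l, Crosses p e) :
    (pathEdges (l.map fun x => a + gap p N x)).map edgeDiff =
      ((pathEdges l).map edgeDiff).map (· + N) := by
  rw [← map_edgeDiff_gap hN hE, ← pathEdges_map,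
    ← map_edgeDiff_add a (pathEdges (l.map (gap p N))), ← pathEdges_map, List.map_map]
  rfl

theorem map_gap_add_verts {p n N a : ℤ} (h0 : 0 ≤ p) (hn : p ≤ n) {l : List ℤ}
    (hl : (l : Multiset ℤ) = Ico 0 n) :
    ((l.map fun x => a + gap p N x : List ℤ) : Multiset ℤ) =
      Ico (a + 0) (a + p) + Ico (a + (p + N)) (a + (n + N)) := by
  rw [← map_add_left_Ico, ← map_add_left_Ico, ← Multiset.map_add, ← map_gap_Ico h0 hn, ← hl,
    Multiset.map_map]
  rfl

/-- The main step: adding an odd cycle. -/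
theorem GoodLab.insert_odd {N z : ℤ} {L : List ℕ} (k : ℕ) (h : GoodLab N z L) (hN : N % 2 = 0)
    (hz : 0 ≤ z) (hzN : 2 * z ≤ N) (hk : 3 * k + 4 ≤ N) (hk' : N ≠ 3 * k + 6) :
    GoodLab (5 * N + 8 - 2 * z) (2 * N + 3 - z) ((2 * k + 3) :: L) := by
  obtain ⟨v, rfl⟩ : ∃ v, N = 2 * v := ⟨N / 2, by omega⟩
  -- Here `1 ≤ c ≤ v + 1`, and `c` is the half-width of the padding that brings the inner end `z` to
  -- the label `4v + 4`.
  obtain ⟨c, rfl⟩ : ∃ c, z = v + 1 - c := ⟨v + 1 - z, by omega⟩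
  obtain ⟨t, l0, cs, a1, a2, a3, a4, a5, -⟩ := h
  obtain ⟨l, q, b1, b2, b3, b4, b5, b6, b7, b8⟩ := openLab_zigzag k hN hk hk'
  obtain ⟨l1, c1, c2, c3, c4, c5⟩ :=
    (alphaLab_zigzag_mirror (n := 2 * v + 1) (by omega)).exists_path
  obtain ⟨l2, d1, d2, d3, d4, d5⟩ := (alphaLab_zigzag (n := 2 * c) (by omega)).exists_path
  -- Four layers from outside in: the open labelling (`f`), a zigzag on `2v + 1` labels (`f1`), a
  -- zigzag on `2c` labels (`f2`) and the given labelling (`f0`). The gaps leave only the label `3v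
  -- + 2` unused, and it closes the strand into the odd cycle.
  let R : ℤ := 4 * v + 2 + 2 * c
  let f : ℤ → ℤ := fun x => 0 + gap (2 * v + 2) R x
  let f1 : ℤ → ℤ := fun x => (2 * v + 2) + gap ((2 * v + 1) / 2) (2 * v + 1 + 2 * c) x
  let f2 : ℤ → ℤ := fun x => (3 * v + 3) + gap ((2 * c + 1) / 2) (2 * v) x
  let f0 : ℤ → ℤ := fun x => (3 * v + 3 + c) + x
  have e1 : f 0 = 0 := by simp only [f]; rw [gap_of_lt (by omega)]; rfl
  have e2 : f (2 * v + 3) = 6 * v + 5 + 2 * c := by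
    simp only [f, R]; rw [gap_of_le (by omega)]; ring
  have e3 : f (2 * v / 2 + 2) = v + 2 := by
    simp only [f]; rw [gap_of_lt (by omega)]; omega
  have e4 : f (3 * (2 * v / 2) + 2) = 7 * v + 4 + 2 * c := by
    simp only [f, R]; rw [gap_of_le (by omega)]; omega
  have e5 : f1 (2 * v + 1 - 1) = 6 * v + 3 + 2 * c := by
    simp only [f1]; rw [gap_of_le (by omega)]; ring
  have e6 : f1 (2 * v + 1 - 1 - (2 * v + 1) / 2) = 5 * v + 3 + 2 * c := by
    simp only [f1]; rw [gap_of_le (by omega)]; omega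
  have e7 : f2 0 = 3 * v + 3 := by
    simp only [f2]; rw [gap_of_lt (by omega)]; ring
  have e8 : f2 (2 * c / 2) = 5 * v + 3 + c := by
    simp only [f2]; rw [gap_of_le (by omega)]; omega
  have e9 : f0 (v + 1 - c) = 4 * v + 4 := by simp only [f0]; ring
  have m1 : (l.map f).head? = some 0 := by rw [List.head?_map, b1, Option.map_some, e1]
  have m2 : (l.map f).getLast? = some (6 * v + 5 + 2 * c) := by
    rw [List.getLast?_map, b2, Option.map_some, e2]
  have m3 : (q.map f).head? = some (v + 2) := by rw [List.head?_map, b3, Option.map_some, e3]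
  have m4 : (q.map f).getLast? = some (7 * v + 4 + 2 * c) := by
    rw [List.getLast?_map, b4, Option.map_some, e4]
  have m5 : (l1.map f1).reverse.getLast? = some (6 * v + 3 + 2 * c) := by
    rw [List.getLast?_reverse, List.head?_map, c1, Option.map_some, e5]
  have m6 : (l1.map f1).reverse.head? = some (5 * v + 3 + 2 * c) := by
    rw [List.head?_reverse, List.getLast?_map, c2, Option.map_some, e6]
  have m7 : (l2.map f2).reverse.getLast? = some (3 * v + 3) := by
    rw [List.getLast?_reverse, List.head?_map, d1, Option.map_some, e7]
  have m8 : (l2.map f2).reverse.head? = some (5 * v + 3 + c) := by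
    rw [List.head?_reverse, List.getLast?_map, d2, Option.map_some, e8]
  have m9 : (l0.map f0).head? = some (4 * v + 4) := by rw [List.head?_map, a1, Option.map_some, e9]
  have key : GoodLab (8 * v + 6 + 2 * c) (5 * v + 3 + c) ((2 * k + 3) :: L) := by
    refine ⟨f0 t, (l2.map f2).reverse ++ ((l1.map f1).reverse ++ (l.map f ++ l0.map f0)),
      (q.map f ++ [3 * v + 2]) :: cs.map (List.map f0), ?_, ?_, ?_, ?_, ?_, fun _ _ => trivial⟩
    · simp only [List.head?_append, m8, Option.some_or]
    · have : (l0.map f0).getLast? = some (f0 t) := by rw [List.getLast?_map, a2, Option.map_some]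
      simp only [List.getLast?_append, this, Option.some_or]
    · rw [List.map_cons, List.map_map, ← a3]
      congr 1
      · simp [b5]
      · congr 1; ext; simp
    · rw [labVerts_append_left, labVerts_append_left, labVerts_append_left, labVerts_cons,
        labVerts_map, a4, Multiset.coe_reverse, Multiset.coe_reverse,
        map_gap_add_verts (by omega) (by omega) c3, map_gap_add_verts (by omega) (by omega) d3,
        map_add_left_Ico, ← Multiset.coe_add]
      have hq : ((l.map f : List ℤ) : Multiset ℤ) + ((q.map f : List ℤ) : Multiset ℤ) =
          Ico (0 + 0) (0 + (2 * v + 2)) + Ico (0 + (2 * v + 2 + R)) (0 + (2 * (2 * v) + 4 + R)) := by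
        rw [Multiset.coe_add] at b6 ⊢
        rw [← List.map_append]
        exact map_gap_add_verts (by omega) (by omega) b6
      have hrw : ∀ A B C D E F : Multiset ℤ, A + (B + (C + (D + E + F))) = C + D + A + B + E + F := by
        intros; abel
      rw [hrw, hq]
      apply eq_Ico_of_cover
      · simp only [Multiset.card_add, card_Ico_int, R, Multiset.coe_card, List.length_singleton]
        omega
      · intro x h1 h2
        simp only [Multiset.mem_add, Multiset.mem_Ico, Multiset.mem_coe, List.mem_singleton, R]
        omega
    · have n3 : (l.map f ++ l0.map f0).head? = some 0 := by
        simp only [List.head?_append, m1, Option.some_or]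
      have n2 : ((l1.map f1).reverse ++ (l.map f ++ l0.map f0)).head? =
          some (5 * v + 3 + 2 * c) := by
        simp only [List.head?_append, m6, Option.some_or]
      have hc : cycleEdges (q.map f ++ [3 * v + 2]) =
          (3 * v + 2, v + 2) ::ₘ (7 * v + 4 + 2 * c, 3 * v + 2) ::ₘ pathEdges (q.map f) := by
        rw [cycleEdges_eq (x := v + 2) (y := 3 * v + 2)
          (by simp only [List.head?_append, m3, Option.some_or]) (by simp),
          pathEdges_append m4 (y := 3 * v + 2) rfl, pathEdges]
        simp only [← Multiset.singleton_add]
        abel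
      rw [labEdges_append_left _ m7 n2, labEdges_append_left _ m5 n3, labEdges_append_left _ m2 m9,
        labEdges_cons, labEdges_map, hc]
      simp only [Multiset.map_cons, Multiset.map_add, Multiset.cons_add, Multiset.add_cons]
      rw [map_edgeDiff_add, a5, pathEdges_reverse, pathEdges_reverse, map_edgeDiff_swap,
        map_edgeDiff_swap, map_gap_add_edgeDiff (by omega) c5, map_gap_add_edgeDiff (by omega) d5,
        c4, d4, map_add_Ico, map_add_Ico]
      have hq : (2 * (2 * v) + 1 - (2 * v) + R) ::ₘ ((pathEdges (l.map f)).map edgeDiff +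
          (pathEdges (q.map f)).map edgeDiff) = Ico (1 + R) (2 * (2 * v) + 4 + R) := by
        rw [map_gap_add_edgeDiff (by omega) fun e he => b8 e (Multiset.mem_add.2 (Or.inl he)),
          map_gap_add_edgeDiff (by omega) fun e he => b8 e (Multiset.mem_add.2 (Or.inr he)),
          ← Multiset.map_add, ← Multiset.map_add, ← map_add_Ico, ← b7, Multiset.map_cons]
        congr 1; ring
      simp only [edgeDiff_mk]
      -- Three links and the two edges at `3v + 2` supply the five differences left out by the
      -- layers. The second link has the difference missing from the open labelling.
      rw [abs_sub_eq (a := 3 * v + 3) (c := 2 * v + 2 * c) (by omega) (by omega),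
        abs_sub_eq (a := 6 * v + 3 + 2 * c) (c := 2 * (2 * v) + 1 - (2 * v) + R) (by omega)
          (by omega),
        abs_sub_eq (a := 6 * v + 5 + 2 * c) (c := 2 * v + 2 * c + 1) (by omega) (by omega),
        abs_sub_eq (a := 3 * v + 2) (c := 2 * v) (by omega) (by omega),
        abs_sub_eq (a := 7 * v + 4 + 2 * c) (c := R) (by omega) (by omega)]
      have hrw : ∀ (x1 x2 x3 x4 x5 : ℤ) (A B C D E : Multiset ℤ),
          x1 ::ₘ x2 ::ₘ x3 ::ₘ x4 ::ₘ x5 ::ₘ (A + (B + (C + (D + E)))) =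
            x1 ::ₘ x3 ::ₘ x4 ::ₘ x5 ::ₘ (A + B + E + x2 ::ₘ (C + D)) := by
        intros; simp only [← Multiset.singleton_add]; abel
      rw [hrw, hq]
      apply eq_Ico_of_cover
      · simp only [Multiset.card_cons, Multiset.card_add, card_Ico_int, R]
        omega
      · intro x h1 h2
        simp only [Multiset.mem_cons, Multiset.mem_add, Multiset.mem_Ico, R]
        omega
  -- Mirroring puts the new end in the lower half, as the next insertion requires.
  exact key.mirror.congr (by omega) (by omega)

/-! ### Wrapping even cycles, and starting labellings -/

/-- Wrapping even cycles around a labelling. -/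
theorem GoodLab.insert_even_cycles {N d n : ℤ} {L : List ℕ} (h : GoodLab N d L) (ks : List ℕ)
    (hd : 0 ≤ d) (hN : d < N) (hks : evenSize ks + 3 ≤ 2 * d) (hn : N + 4 * d + 6 ≤ n) :
    GoodLab n d ((ks.map fun k => 2 * k + 4) ++ L) := by
  -- Both wrapper sizes have cut `d + 2`, so their end `1` links to the mirrored end of the inner
  -- path, and both return the free end to `d`. Having both parities lets `enlarge_even` reach every
  -- remaining size.
  have key : ∀ m : ℤ, m = 2 * d + 3 ∨ m = 2 * d + 4 →
      GoodLab (m + N) d ((ks.map fun k => 2 * k + 4) ++ L) := by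
    intro m hm
    have := (alphaLab_even_cycles (M := m - evenSize ks) (by omega) (by omega) ks).reverse.nest_good
      h.mirror (by omega) (by omega) (by omega) ?_
    · rcases hm with rfl | rfl
      · refine this.congr (by omega) ?_
        rw [pathEnd, if_neg (by omega), gap_of_lt (by omega)]; omega
      · refine this.mirror.congr (by omega) ?_
        rw [pathEnd, if_pos (by omega), gap_of_le (by omega)]; omega
    · rw [gap_of_lt (by omega)]; exact abs_sub_eq (by omega) (by omega)
  rcases Int.even_or_odd' (n - N - (2 * d + 3)) with ⟨p, hp | hp⟩
  · exact ((key _ (Or.inl rfl)).enlarge_even hd (by omega) (p := p) (by omega)).congr (by omega) rfl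
  · exact ((key _ (Or.inr rfl)).enlarge_even hd (by omega) (p := p) (by omega)).congr (by omega) rfl

theorem goodLab_path {n : ℤ} (hn : 2 ≤ n) : GoodLab n (n - 2) [] := by
  by_cases h2 : n = 2
  · subst h2
    exact (alphaLab_zigzag (n := 2) (by omega)).good
  by_cases h5 : n = 5
  · subst h5
    refine ⟨1, [3, 2, 0, 4, 1], [], rfl, rfl, rfl, ?_, ?_, fun _ _ => trivial⟩ <;> decide
  · exact (alphaLab_path_one (M := n) (by omega) h5).good.mirror.congr rfl (by omega)

/-- A cycle of odd length and a path. -/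
theorem goodLab_odd_cycle {k : ℕ} (hk : 1 ≤ k) : GoodLab (3 * k + 1) k [2 * k + 1] := by
  rcases (by omega : k = 1 ∨ k = 2 ∨ 3 ≤ k) with rfl | rfl | h3
  · refine ⟨1, [1], [[0, 3, 2]], rfl, rfl, rfl, ?_, ?_, fun _ _ => trivial⟩ <;> decide
  · refine ⟨3, [2, 3], [[0, 5, 1, 4, 6]], rfl, rfl, rfl, ?_, ?_, fun _ _ => trivial⟩ <;> decide
  -- The cycle is a zigzag on the outer `2k` labels closed through `k + 1`; the path starts at `k`
  -- and continues on the `k - 1` labels `k + 2, …, 2k`.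
  obtain ⟨t, l, cs, a1, a2, a3, a4, a5, -⟩ := goodLab_path (n := k - 1) (by omega)
  obtain rfl : cs = [] := by simpa using a3
  simp only [labVerts, labEdges, List.flatten_nil, Multiset.coe_nil, add_zero, List.map_nil,
    List.sum_nil] at a4 a5
  obtain ⟨m, hm⟩ : ∃ m, 2 * k = m + 1 := ⟨2 * k - 1, by omega⟩
  let g : ℕ → ℤ := fun i => if i % 2 = 0 then i / 2 else 3 * k - i / 2
  have hg0 : ((List.range (m + 1)).map g ++ [(k + 1 : ℤ)]).head? = some 0 := by
    rw [List.head?_append, head?_map_range]; simp [g]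
  have hgl : ((List.range (m + 1)).map g).getLast? = some (2 * k + 1 : ℤ) := by
    rw [getLast?_map_range]; congr 1; simp only [g]; split_ifs <;> omega
  have hc : cycleEdges ((List.range (m + 1)).map g ++ [(k + 1 : ℤ)]) =
      (Multiset.range m).map (fun i => (g i, g (i + 1))) + {((2 * k + 1 : ℤ), (k + 1 : ℤ))} +
        {((k + 1 : ℤ), 0)} := by
    rw [cycleEdges_eq hg0 (y := (k + 1 : ℤ)) (by simp), pathEdges_append hgl (y := (k + 1 : ℤ)) rfl,
      pathEdges_range]
    rfl
  have hl : (l.map ((k + 2 : ℤ) + ·)).head? = some (2 * k - 1 : ℤ) := by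
    rw [List.head?_map, a1, Option.map_some]; congr 1; ring
  have hp : pathEdges ((k : ℤ) :: l.map ((k + 2 : ℤ) + ·)) =
      ((k : ℤ), (2 * k - 1 : ℤ)) ::ₘ (pathEdges l).map (Prod.map ((k + 2 : ℤ) + ·) ((k + 2 : ℤ) + ·)) := by
    have := pathEdges_append (l := [(k : ℤ)]) rfl hl
    simpa [pathEdges, pathEdges_map] using this
  refine ⟨(k + 2) + t, (k : ℤ) :: l.map ((k + 2 : ℤ) + ·),
    [(List.range (m + 1)).map g ++ [(k + 1 : ℤ)]], rfl, ?_, ?_, ?_, ?_, fun _ _ => trivial⟩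
  · simp [List.getLast?_cons, a2]
  · simp; omega
  · have hv : ((l.map ((k + 2 : ℤ) + ·) : List ℤ) : Multiset ℤ) =
        Ico (k + 2 + 0 : ℤ) (k + 2 + (k - 1) : ℤ) := by
      rw [← map_add_left_Ico, ← a4]; rfl
    rw [labVerts, ← Multiset.cons_coe, hv, List.flatten_singleton, ← Multiset.coe_add]
    apply eq_Ico_of_cover
    · simp only [Multiset.card_add, Multiset.card_cons, card_Ico_int, Multiset.coe_card,
        List.length_map, List.length_range, List.length_singleton]
      omega
    · intro x h1 h2
      simp only [Multiset.mem_cons, Multiset.mem_add, Multiset.mem_Ico, Multiset.mem_coe,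
        List.mem_singleton, List.mem_map, List.mem_range]
      by_cases hx : x < k
      · exact Or.inr (Or.inl ⟨(2 * x).toNat, by omega, by simp only [g]; split_ifs <;> omega⟩)
      by_cases hx' : 2 * k + 1 ≤ x
      · exact Or.inr (Or.inl ⟨(2 * (3 * k - x) + 1).toNat, by omega,
          by simp only [g]; split_ifs <;> omega⟩)
      omega
  · rw [labEdges, List.map_singleton, List.sum_singleton, hc, hp]
    simp only [Multiset.map_add, Multiset.map_cons, Multiset.map_singleton, edgeDiff_mk]
    rw [map_edgeDiff_add, a5, abs_sub_eq (c := k - 1) (by omega) (by omega),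
      abs_sub_eq (a := 2 * k + 1) (c := k) (by omega) (by omega),
      abs_sub_eq (a := k + 1) (c := k + 1) (by omega) (by omega), Multiset.map_map]
    apply eq_Ico_of_cover
    · simp only [Multiset.card_add, Multiset.card_cons, card_Ico_int, Multiset.card_map,
        Multiset.card_range, Multiset.card_singleton]
      omega
    · intro x h1 h2
      simp only [Multiset.mem_cons, Multiset.mem_add, Multiset.mem_Ico, Multiset.mem_singleton,
        Multiset.mem_map, Multiset.mem_range]
      by_cases hx : x < k + 2
      · omega
      · refine Or.inr (Or.inl (Or.inl ⟨(3 * k - x).toNat, by omega, abs_sub_eq (by omega) ?_⟩))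
        simp only [g]
        split_ifs <;> omega

/-! ### Repeated insertion of odd cycles -/

/-- The effect of `GoodLab.insert_odd` on the number of vertices and on the end of the path. -/
def oddStep (a : ℤ × ℤ) : ℤ × ℤ := (5 * a.1 + 8 - 2 * a.2, 2 * a.1 + 3 - a.2)

theorem oddStep_fst (a : ℤ × ℤ) : (oddStep a).1 = 5 * a.1 + 8 - 2 * a.2 := rfl

theorem oddStep_snd (a : ℤ × ℤ) : (oddStep a).2 = 2 * a.1 + 3 - a.2 := rfl

theorem oddStep_iterate_inv {a : ℤ × ℤ} (h0 : a.1 % 2 = 0) (h1 : 0 ≤ a.2) (h2 : 2 * a.2 ≤ a.1)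
    (m : ℕ) : (oddStep^[m] a).1 % 2 = 0 ∧ 0 ≤ (oddStep^[m] a).2 ∧
      2 * (oddStep^[m] a).2 ≤ (oddStep^[m] a).1 ∧ a.1 ≤ (oddStep^[m] a).1 := by
  induction m with
  | zero => exact ⟨h0, h1, h2, le_rfl⟩
  | succ m ih =>
    rw [Function.iterate_succ_apply', oddStep_fst, oddStep_snd]
    omega

/-- If `(N', z')` follows `(N, z)`, then `8z' - 3N' = N - 2z`, which is nonnegative by the
invariant. -/
theorem oddStep_iterate_succ_le {a : ℤ × ℤ} (h0 : a.1 % 2 = 0) (h1 : 0 ≤ a.2)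
    (h2 : 2 * a.2 ≤ a.1) (m : ℕ) :
    3 * (oddStep^[m + 1] a).1 ≤ 8 * (oddStep^[m + 1] a).2 := by
  have := oddStep_iterate_inv h0 h1 h2 m
  rw [Function.iterate_succ_apply', oddStep_fst, oddStep_snd]
  omega

/-- From `3N ≤ 8z` one gets `3(2N + 3 - z) ≤ 13z + 9`, well within a factor `7`. The form `20(z +
1)` is chosen because `3(N + 4z + 6) ≤ 20z + 18`, so it bounds three times the size needed for the
final enlargement. -/
theorem oddStep_iterate_growth {a : ℤ × ℤ} (h0 : a.1 % 2 = 0) (h1 : 0 ≤ a.2)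
    (h2 : 2 * a.2 ≤ a.1) {C : ℤ} (hC : 20 * ((oddStep^[2] a).2 + 1) ≤ 7 * C) (m : ℕ) :
    20 * ((oddStep^[m + 2] a).2 + 1) ≤ 7 ^ (m + 1) * C := by
  induction m with
  | zero => simpa using hC
  | succ m ih =>
    have i1 : 3 * (oddStep^[m + 2] a).1 ≤ 8 * (oddStep^[m + 2] a).2 :=
      oddStep_iterate_succ_le h0 h1 h2 (m + 1)
    have i2 := oddStep_iterate_inv h0 h1 h2 (m + 2)
    rw [show m + 1 + 2 = (m + 2) + 1 by ring, Function.iterate_succ_apply', oddStep_snd,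
      pow_succ, mul_comm _ (7 : ℤ), mul_assoc]
    omega

/-- Sizes never decrease, so `3 * K + 7 ≤ N` keeps clear of the excluded `N = 3j + 6` at every
insertion. -/
theorem GoodLab.insert_odd_cycles {N z : ℤ} {L : List ℕ} (h : GoodLab N z L) (hN : N % 2 = 0)
    (hz : 0 ≤ z) (hzN : 2 * z ≤ N) {K : ℕ} (hK : 3 * K + 7 ≤ N) (js : List ℕ)
    (hjs : ∀ j ∈ js, j ≤ K) :
    GoodLab (oddStep^[js.length] (N, z)).1 (oddStep^[js.length] (N, z)).2
      ((js.map fun j => 2 * j + 3) ++ L) := by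
  induction js with
  | nil => exact h
  | cons j js ih =>
    have hi := oddStep_iterate_inv (a := (N, z)) hN hz hzN js.length
    have hj : j ≤ K := hjs j (by simp)
    rw [List.length_cons, Function.iterate_succ_apply', oddStep_fst, oddStep_snd]
    simp only at hi
    exact (ih fun i hi => hjs i (List.mem_cons_of_mem _ hi)).insert_odd j hi.1 hi.2.1 hi.2.2.1
      (by omega) (by omega)

/-! ### Odd cycles only -/

theorem goodLab_odd_cycle_even {k K : ℕ} (hk : k ≤ K) : ∃ N : ℤ, N % 2 = 0 ∧ 5 * K + 8 ≤ N ∧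
    N ≤ 5 * K + 11 ∧ GoodLab N (k + 1) [2 * k + 3] := by
  have h : GoodLab (3 * k + 4) (k + 1) [2 * k + 3] :=
    (goodLab_odd_cycle (k := k + 1) (by omega)).congr (by push_cast; ring) (by push_cast; ring)
  -- The window contains two even numbers; `7k + 9` is the size at which `enlarge_odd` from `3k + 4`
  -- with `d = k + 1` meets its excluded case.
  obtain ⟨N, h1, h2, h3, h4⟩ : ∃ N : ℤ, N % 2 = 0 ∧ 5 * K + 8 ≤ N ∧ N ≤ 5 * K + 11 ∧
      N ≠ 7 * k + 9 := by
    by_cases h : 2 * ((5 * K + 9) / 2) = (7 * k + 9 : ℤ)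
    · exact ⟨2 * ((5 * K + 9) / 2) + 2, by omega, by omega, by omega, by omega⟩
    · exact ⟨2 * ((5 * K + 9) / 2), by omega, by omega, by omega, by omega⟩
  refine ⟨N, h1, h2, h3, ?_⟩
  rcases Int.even_or_odd' (N - (3 * k + 4)) with ⟨p, hp | hp⟩
  · exact (h.enlarge_even (by omega) (by omega) (p := p) (by omega)).congr (by omega) rfl
  · exact (h.enlarge_odd (by omega) (by omega) (q := p) (by omega) (by omega)).congr (by omega) rfl

theorem exists_goodLab_odd {js : List ℕ} {K : ℕ} {n : ℤ} (hne : js ≠ []) (hK : ∀ j ∈ js, j ≤ K)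
    (hn : 3 * 7 ^ (js.length - 1) * (4 * K + 7) ≤ n) :
    ∃ d, GoodLab n d (js.map fun j => 2 * j + 3) := by
  obtain ⟨js, k, rfl⟩ : ∃ (js' : List ℕ) (k : ℕ), js = js' ++ [k] :=
    ⟨_, _, (List.dropLast_append_getLast hne).symm⟩
  have hk : k ≤ K := hK k (by simp)
  have hjs : ∀ j ∈ js, j ≤ K := fun j hj => hK j (by simp [hj])
  simp only [List.length_append, List.length_singleton, Nat.add_sub_cancel] at hn
  rw [List.map_append, List.map_singleton]
  rcases js.eq_nil_or_concat with rfl | hjs'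
  · refine ⟨k + 1, ?_⟩
    simp only [List.length_nil, pow_zero] at hn
    exact (((goodLab_odd_cycle (k := k + 1) (by omega)).congr (s' := k + 1) rfl (by simp)).enlarge
      (by omega) (by push_cast; omega) (by push_cast; omega))
  obtain ⟨m, hm⟩ : ∃ m, js.length = m + 1 := by
    obtain ⟨l, b, rfl⟩ := hjs'
    exact ⟨l.length, by simp⟩
  obtain ⟨N, h1, h2, h3, h4⟩ := goodLab_odd_cycle_even hk
  have h5 := h4.insert_odd_cycles h1 (by omega) (by omega) (K := K) (by omega) js hjs
  have h6 := oddStep_iterate_inv (a := (N, (k + 1 : ℤ))) h1 (by simp only; omega)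
    (by simp only; omega) js.length
  refine ⟨_, h5.enlarge h6.2.1 (by simp only at h6; omega) ?_⟩
  rw [hm] at h5 h6 hn ⊢
  -- A single insertion is computed exactly, since the growth bound starts at the second iterate.
  rcases m with _ | m
  · simp only [zero_add, Function.iterate_one, oddStep_fst, oddStep_snd, pow_one] at hn ⊢
    rcases K.eq_zero_or_pos with rfl | hK0 <;> omega
  · have h7 := oddStep_iterate_succ_le (a := (N, (k + 1 : ℤ))) h1 (by simp only; omega)
      (by simp only; omega) (m + 1)
    have h8 := oddStep_iterate_growth (a := (N, (k + 1 : ℤ))) h1 (by simp only; omega)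
      (by simp only; omega) (C := 9 * 7 * (4 * K + 7)) (by
        simp only [Function.iterate_succ, Function.iterate_zero, Function.comp, id, oddStep_fst,
          oddStep_snd]
        omega) m
    rw [show m + 2 = m + 1 + 1 by ring,
      show (7 : ℤ) ^ (m + 1) * (9 * 7 * (4 * K + 7)) = 3 * (3 * 7 ^ (m + 1 + 1) * (4 * K + 7)) by
        ring] at h8
    omega

/-! ### Even and odd cycles -/

/-- `oddStep` is affine, so orbits from neighbouring starts differ by an orbit of its linear part.
The bound is therefore uniform in `y`. -/
theorem oddStep_iterate_increment (y : ℤ) (m : ℕ) :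
    0 ≤ (oddStep^[m + 1] (2 * (y + 1), y + 1)).2 - (oddStep^[m + 1] (2 * y, y)).2 ∧
    2 * ((oddStep^[m + 1] (2 * (y + 1), y + 1)).2 - (oddStep^[m + 1] (2 * y, y)).2) ≤
      (oddStep^[m + 1] (2 * (y + 1), y + 1)).1 - (oddStep^[m + 1] (2 * y, y)).1 ∧
    3 * ((oddStep^[m + 1] (2 * (y + 1), y + 1)).1 - (oddStep^[m + 1] (2 * y, y)).1) ≤
      8 * ((oddStep^[m + 1] (2 * (y + 1), y + 1)).2 - (oddStep^[m + 1] (2 * y, y)).2) ∧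
    (oddStep^[m + 1] (2 * (y + 1), y + 1)).2 - (oddStep^[m + 1] (2 * y, y)).2 ≤ 3 * 7 ^ m := by
  induction m with
  | zero =>
    simp only [zero_add, Function.iterate_one, oddStep_fst, oddStep_snd, pow_zero]
    omega
  | succ m ih =>
    simp only [Function.iterate_succ_apply' oddStep (m + 1), oddStep_fst, oddStep_snd, pow_succ]
    omega

theorem le_oddStep_iterate {y : ℤ} (hy : 0 ≤ y) (m : ℕ) : y ≤ (oddStep^[m] (2 * y, y)).2 := by
  induction m with
  | zero => exact le_rfl
  | succ m ih =>
    have := oddStep_iterate_inv (a := (2 * y, y)) (by simp) hy le_rfl m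
    rw [Function.iterate_succ_apply', oddStep_snd]
    omega

theorem exists_start {K r B : ℕ} {E n : ℤ} (m : ℕ) (hr : 1 ≤ r) (hE : E ≤ r * (3 * B + 5))
    (hn : 12 * r * (2 * B + 7) + 7 ^ (m + 1) * (4 * K + 7) - 6 + (2 * K + 3) ≤ n) :
    ∃ y : ℤ, 3 * K + 4 ≤ 2 * y ∧ 2 * y ≠ 3 * K + 6 ∧
      E + 3 ≤ 2 * (oddStep^[m + 1] (2 * y, y)).2 ∧
      (oddStep^[m + 1] (2 * y, y)).1 + 4 * (oddStep^[m + 1] (2 * y, y)).2 + 6 ≤ n := by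
  have hle : ∀ y : ℤ, 0 ≤ y → 3 * (oddStep^[m + 1] (2 * y, y)).1 ≤
      8 * (oddStep^[m + 1] (2 * y, y)).2 := fun y hy =>
    oddStep_iterate_succ_le (a := (2 * y, y)) (by simp) hy le_rfl m
  have hrB : 0 ≤ (r * B : ℤ) := by positivity
  -- The value `(3 * K + 5) / 2` is the least `y` with `3K + 4 ≤ 2y`. If it already leaves room for
  -- the even cycles, the growth bound finishes.
  by_cases h0 : E + 3 ≤ 2 * (oddStep^[m + 1] (2 * ((3 * K + 5) / 2), (3 * K + 5) / 2)).2
  · refine ⟨(3 * K + 5) / 2, by omega, by omega, h0, ?_⟩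
    rcases m with _ | m
    · simp only [zero_add, Function.iterate_one, oddStep_fst, oddStep_snd, pow_one] at hn ⊢
      nlinarith [Int.ediv_mul_le (3 * K + 5 : ℤ) (b := 2) (by omega)]
    · have h1 := hle ((3 * K + 5) / 2) (by omega)
      have h2 := oddStep_iterate_growth (a := (2 * ((3 * K + 5) / 2), (3 * K + 5 : ℤ) / 2))
        (by simp) (by simp only; omega) le_rfl (C := 21 * (4 * K + 7)) (by
          simp only [Function.iterate_succ, Function.iterate_zero, Function.comp, id, oddStep_fst,
            oddStep_snd]
          omega) m
      rw [show m + 2 = m + 1 + 1 by ring,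
        show (7 : ℤ) ^ (m + 1) * (21 * (4 * K + 7)) = 3 * (7 ^ (m + 1 + 1) * (4 * K + 7)) by
          ring] at h2
      have h3 : (12 * r * (2 * B + 7) : ℤ) = 24 * (r * B) + 84 * r := by ring
      omega
  have hex : ∃ i : ℕ, E + 3 ≤
      2 * (oddStep^[m + 1] (2 * ((3 * K + 5) / 2 + i), ((3 * K + 5) / 2 + i : ℤ))).2 := by
    refine ⟨(E + 3).toNat, ?_⟩
    have := le_oddStep_iterate (y := (3 * K + 5) / 2 + ((E + 3).toNat : ℕ)) (by omega) (m + 1)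
    omega
  classical
  -- By minimality the preceding start is too small for the even cycles, so its end is bounded in
  -- terms of `E`.
  obtain ⟨i, hi⟩ : ∃ i, Nat.find hex = i + 1 := by
    refine Nat.exists_eq_succ_of_ne_zero fun h => h0 ?_
    have := Nat.find_spec hex
    rw [h] at this
    simpa using this
  have h1 := Nat.find_spec hex
  have h2 := Nat.find_min hex (m := i) (by omega)
  rw [hi] at h1
  set y : ℤ := (3 * K + 5) / 2 + i with hy
  have hy1 : (3 * K + 5) / 2 + ((i + 1 : ℕ) : ℤ) = y + 1 := by push_cast; ring
  rw [hy1] at h1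
  have i1 := oddStep_iterate_increment y m
  have i2 := oddStep_iterate_increment (y + 1) m
  have h3 : (12 * r * (2 * B + 7) : ℤ) = 24 * (r * B) + 84 * r := by ring
  have h4 : (r * (3 * B + 5) : ℤ) = 3 * (r * B) + 5 * r := by ring
  have h5 : (7 : ℤ) ^ (m + 1) * (4 * K + 7) = 28 * (K * 7 ^ m) + 49 * 7 ^ m := by ring
  have h6 : 0 ≤ (K * 7 ^ m : ℤ) := by positivity
  have h7 : 0 ≤ (7 ^ m : ℤ) := by positivity
  -- One more step avoids the excluded size. Each step adds at most `3 * 7 ^ m` to the end, about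
  -- `20 * 7 ^ m` to the required size, and two steps fit into the available `49 * 7 ^ m`.
  by_cases hy2 : 2 * (y + 1) = 3 * K + 6
  · have h8 := hle (y + 1 + 1) (by omega)
    exact ⟨y + 1 + 1, by omega, by omega, by omega, by omega⟩
  · have h8 := hle (y + 1) (by omega)
    exact ⟨y + 1, by omega, hy2, h1, by omega⟩

theorem evenSize_le {ks : List ℕ} {B : ℕ} (h : ∀ k ∈ ks, k ≤ B) :
    evenSize ks ≤ ks.length * (3 * B + 5) := by
  rw [evenSize, ← smul_eq_mul, ← List.length_map (fun k => 3 * k + 5)]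
  refine List.sum_le_card_nsmul _ _ fun x hx => ?_
  obtain ⟨k, hk, rfl⟩ := List.mem_map.1 hx
  have := h k hk
  omega

theorem exists_goodLab_mixed {ks js : List ℕ} {B K : ℕ} {n : ℤ} (hks : ks ≠ []) (hjs : js ≠ [])
    (hB : ∀ k ∈ ks, k ≤ B) (hK : ∀ j ∈ js, j ≤ K)
    (hn : 12 * ks.length * (2 * B + 7) + 7 ^ js.length * (4 * K + 7) - 6 + (2 * K + 3) ≤ n) :
    ∃ d, GoodLab n d ((ks.map fun k => 2 * k + 4) ++ js.map fun j => 2 * j + 3) := by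
  obtain ⟨js, j, rfl⟩ : ∃ (js' : List ℕ) (k : ℕ), js = js' ++ [k] :=
    ⟨_, _, (List.dropLast_append_getLast hjs).symm⟩
  have hj : j ≤ K := hK j (by simp)
  have hjs : ∀ i ∈ js, i ≤ K := fun i hi => hK i (by simp [hi])
  rw [List.length_append, List.length_singleton] at hn
  obtain ⟨y, h1, h2, h3, h4⟩ := exists_start (E := evenSize ks) js.length
    (List.length_pos_iff.2 hks) (by exact_mod_cast evenSize_le hB) hn
  have hy : GoodLab (2 * y) y [] :=
    (alphaLab_even_path (p := y) (a := 0) le_rfl (by omega)).reverse.good.congr rfl (by ring)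
  -- The first insertion is separate because `2y` may lie below `3K + 7`; afterwards the size is `8y
  -- + 8`.
  have h5 := hy.insert_odd j (by omega) (by omega) le_rfl (by omega) (by omega)
  have h6 := h5.insert_odd_cycles (by omega) (by omega) (by omega) (K := K) (by omega) js hjs
  have h7 := oddStep_iterate_inv (a := (2 * y, y)) (by simp) (by simp only; omega) le_rfl
    (js.length + 1)
  rw [List.map_append, List.map_singleton]
  rw [Function.iterate_succ_apply] at h3 h4 h7
  refine ⟨_, h6.insert_even_cycles ks h7.2.1 ?_ h3 h4⟩
  have h8 := h7.2.2
  simp only at h8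
  change (oddStep^[js.length] (oddStep (2 * y, y))).2 < (oddStep^[js.length] (oddStep (2 * y, y))).1
  omega

/-! ### Even cycles only -/

theorem exists_goodLab_even {ks : List ℕ} {n : ℤ} (hn : evenSize ks + 6 ≤ n) :
    ∃ d, GoodLab n d (ks.map fun k => 2 * k + 4) :=
  ⟨1, ((alphaLab_even_cycles (M := n - evenSize ks) (by omega) (by omega) ks).good).congr
    (by omega) rfl⟩

/-! ### Developing a labelling modulo `n` -/

/-- The vertex with a given label; `-1` is the label of the fixed point. -/
def labelVertex (n : ℕ) (x : ℤ) : Option (ZMod n) := if x < 0 then none else some x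

theorem labelVertex_neg_one (n : ℕ) : labelVertex n (-1) = none := by simp [labelVertex]

theorem labelVertex_of_nonneg (n : ℕ) {x : ℤ} (hx : 0 ≤ x) : labelVertex n x = some (x : ZMod n) :=
  if_neg (not_lt.2 hx)

theorem intCast_inj_of_lt {n : ℕ} {x y : ℤ} (hx : 0 ≤ x) (hxn : x < n) (hy : 0 ≤ y) (hyn : y < n)
    (h : (x : ZMod n) = y) : x = y := by
  rw [ZMod.intCast_eq_intCast_iff] at h
  rw [Int.ModEq, Int.emod_eq_of_lt hx hxn, Int.emod_eq_of_lt hy hyn] at h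
  exact h

theorem exists_intCast_eq {n : ℕ} [NeZero n] (a : ZMod n) :
    ∃ x : ℤ, 0 ≤ x ∧ x < n ∧ (x : ZMod n) = a :=
  ⟨a.val, by positivity, by exact_mod_cast a.val_lt, by simp⟩

open Classical in
/-- Every difference modulo `n` occurs exactly twice, up to orientation. -/
theorem card_translates {n : ℕ} [NeZero n] {E : Multiset (ℤ × ℤ)}
    (hE : ∀ e ∈ E, 0 ≤ e.1 ∧ e.1 < n ∧ 0 ≤ e.2 ∧ e.2 < n)
    (hD : E.map edgeDiff = Ico 1 (n : ℤ)) {a b : ZMod n} (hab : a ≠ b) :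
    (Finset.univ.filter fun g : ZMod n => ∃ e ∈ E, (a - g = e.1 ∧ b - g = e.2) ∨
      (b - g = e.1 ∧ a - g = e.2)).card = 2 := by
  have huniq := Multiset.inj_on_of_nodup_map (f := edgeDiff) (s := E)
    (by rw [hD]; exact Multiset.nodup_Ico)
  have hex : ∀ k : ℤ, 1 ≤ k → k < n → ∃ u w : ℤ, w - u = k ∧ ((u, w) ∈ E ∨ (w, u) ∈ E) := by
    intro k h1 h2
    have : k ∈ E.map edgeDiff := by rw [hD, Multiset.mem_Ico]; exact ⟨h1, h2⟩
    obtain ⟨⟨u, w⟩, he, hk⟩ := Multiset.mem_map.1 this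
    rw [edgeDiff_mk] at hk
    rcases abs_cases (u - w) with ⟨h, -⟩ | ⟨h, -⟩
    · exact ⟨w, u, by omega, Or.inr he⟩
    · exact ⟨u, w, by omega, Or.inl he⟩
  have huni : ∀ u w u' w' : ℤ, ((u, w) ∈ E ∨ (w, u) ∈ E) → ((u', w') ∈ E ∨ (w', u') ∈ E) →
      w - u = w' - u' → w ≠ u → u = u' ∧ w = w' := by
    intro u w u' w' h h' heq hne
    have e1 : edgeDiff (u, w) = edgeDiff (u', w') := by
      rw [edgeDiff_mk, edgeDiff_mk, abs_sub_comm, heq, abs_sub_comm]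
    have e2 : ∀ x y, edgeDiff (x, y) = edgeDiff (y, x) := fun x y => abs_sub_comm _ _
    rcases h with h | h <;> rcases h' with h' | h'
    · have := huniq _ h _ h' e1
      simp only [Prod.mk.injEq] at this; omega
    · have := huniq _ h _ h' (e1.trans (e2 _ _))
      simp only [Prod.mk.injEq] at this; omega
    · have := huniq _ h _ h' ((e2 _ _).trans e1)
      simp only [Prod.mk.injEq] at this; omega
    · have := huniq _ h _ h' ((e2 _ _).trans (e1.trans (e2 _ _)))
      simp only [Prod.mk.injEq] at this; omega
  have hrange : ∀ u w : ℤ, ((u, w) ∈ E ∨ (w, u) ∈ E) → 0 ≤ u ∧ u < n ∧ 0 ≤ w ∧ w < n := by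
    rintro u w (h | h)
    · exact hE _ h
    · have := hE _ h
      simp only at this; omega
  obtain ⟨d, hd0, hdn, hd⟩ := exists_intCast_eq (b - a)
  have hd1 : 1 ≤ d := by
    rcases hd0.lt_or_eq with h | h
    · omega
    · rw [← h, Int.cast_zero] at hd
      exact absurd (sub_eq_zero.1 hd.symm).symm hab
  -- The residue `b - a` has two representatives of absolute value below `n`, namely `d` and `d -
  -- n`, and each is realised by one oriented edge. If `n = 2d`, these are the two orientations of
  -- the same edge.
  obtain ⟨u1, w1, h1, m1⟩ := hex d hd1 hdn
  obtain ⟨w2, u2, h2, m2⟩ := hex (n - d) (by omega) (by omega)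
  have r1 := hrange _ _ m1
  have r2 := hrange _ _ m2
  have hne : a - (u1 : ZMod n) ≠ a - (u2 : ZMod n) := by
    intro h
    have := intCast_inj_of_lt r1.1 r1.2.1 r2.2.2.1 r2.2.2.2 (sub_right_injective h)
    omega
  have hset : (Finset.univ.filter fun g : ZMod n => ∃ e ∈ E, (a - g = e.1 ∧ b - g = e.2) ∨
      (b - g = e.1 ∧ a - g = e.2)) = {a - (u1 : ZMod n), a - (u2 : ZMod n)} := by
    ext g
    simp only [Finset.mem_filter, Finset.mem_univ, true_and, Finset.mem_insert,
      Finset.mem_singleton]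
    have hE' : (∃ e ∈ E, (a - g = e.1 ∧ b - g = e.2) ∨ (b - g = e.1 ∧ a - g = e.2)) ↔
        ∃ u w : ℤ, ((u, w) ∈ E ∨ (w, u) ∈ E) ∧ a - g = u ∧ b - g = w := by
      constructor
      · rintro ⟨⟨u, w⟩, he, h | h⟩
        · exact ⟨u, w, Or.inl he, h⟩
        · exact ⟨w, u, Or.inr he, h.2, h.1⟩
      · rintro ⟨u, w, he | he, h⟩
        · exact ⟨_, he, Or.inl h⟩
        · exact ⟨_, he, Or.inr ⟨h.2, h.1⟩⟩
    rw [hE']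
    constructor
    · rintro ⟨u, w, he, hu, hw⟩
      have r := hrange _ _ he
      have hmod : ((w - u : ℤ) : ZMod n) = (d : ℤ) := by
        rw [hd]; push_cast; rw [← hu, ← hw]; ring
      rcases le_or_gt u w with huw | huw
      · have := intCast_inj_of_lt (by omega) (by omega) hd0 hdn hmod
        obtain ⟨rfl, rfl⟩ := huni u w u1 w1 he m1 (by omega) (by omega)
        left; rw [← hu]; ring
      · have hmod' : ((w - u + n : ℤ) : ZMod n) = (d : ℤ) := by
          rw [← hmod]; push_cast; simp
        have := intCast_inj_of_lt (by omega) (by omega) hd0 hdn hmod'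
        obtain ⟨rfl, rfl⟩ := huni w u w2 u2 he.symm m2 (by omega) (by omega)
        right; rw [← hu]; ring
    · rintro (rfl | rfl)
      · refine ⟨u1, w1, m1, by ring, ?_⟩
        have : (w1 : ZMod n) = u1 + (b - a) := by rw [← hd, ← h1]; push_cast; ring
        rw [this]; ring
      · refine ⟨u2, w2, m2.symm, by ring, ?_⟩
        have : (w2 : ZMod n) = u2 + (b - a) := by
          rw [← hd, show w2 = u2 + d - n by omega]; push_cast; simp
        rw [this]; ring
  rw [hset, Finset.card_pair hne]

/-! ### The translation group and the developed factorization -/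

/-- Translation by `g`, fixing the point `none`. -/
def translate {n : ℕ} (g : ZMod n) : Equiv.Perm (Option (ZMod n)) := (Equiv.addRight g).optionCongr

theorem translate_none {n : ℕ} (g : ZMod n) : translate g none = none := rfl

theorem translate_some {n : ℕ} (g a : ZMod n) : translate g (some a) = some (a + g) := rfl

theorem translate_translate {n : ℕ} (g k : ZMod n) (x : Option (ZMod n)) :
    translate g (translate k x) = translate (k + g) x := by
  cases x
  · rfl
  · simp [translate_some, add_assoc]

theorem translate_zero {n : ℕ} (x : Option (ZMod n)) : translate 0 x = x := by
  cases x
  · rfl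
  · simp [translate_some]

theorem translate_symm {n : ℕ} (g : ZMod n) : (translate g).symm = translate (-g) := by
  ext1 x
  rw [Equiv.symm_apply_eq, translate_translate, neg_add_cancel, translate_zero]

theorem map_perm_adj {V : Type*} (G : SimpleGraph V) (p : Equiv.Perm V) (x y : V) :
    (G.map p).Adj x y ↔ G.Adj (p.symm x) (p.symm y) := by
  rw [← (SimpleGraph.Iso.map p G).map_adj_iff]
  simp [SimpleGraph.Iso.map]

/-- A graph whose vertices are labelled gracefully, the cycle through the fixed point being opened
there, develops into a `1`-rotational factorization. -/
theorem exists_oneRotational {V : Type*} (F : SimpleGraph V) {n : ℕ} [NeZero n]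
    (ψ : V ≃ Option (ZMod n)) {s t : ℤ} {E : Multiset (ℤ × ℤ)} (hs : 0 ≤ s ∧ s < n)
    (ht : 0 ≤ t ∧ t < n) (hst : s ≠ t)
    (hE : ∀ e ∈ E, 0 ≤ e.1 ∧ e.1 < n ∧ 0 ≤ e.2 ∧ e.2 < n)
    (hD : E.map edgeDiff = Ico 1 (n : ℤ))
    (hadj : ∀ x y, F.Adj x y ↔ ∃ e ∈ (-1, s) ::ₘ (t, -1) ::ₘ E,
      (ψ x = labelVertex n e.1 ∧ ψ y = labelVertex n e.2) ∨
      (ψ y = labelVertex n e.1 ∧ ψ x = labelVertex n e.2)) :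
    ∃ S : Multiset (SimpleGraph V), IsFactorization 2 F S ∧ IsOneRotational S := by
  classical
  let P : ZMod n → Equiv.Perm V := fun g => (ψ.trans (translate g)).trans ψ.symm
  have hP : ∀ g x, P g x = ψ.symm (translate g (ψ x)) := fun _ _ => rfl
  have hPs : ∀ g x, (P g).symm x = ψ.symm (translate (-g) (ψ x)) := by
    intro g x; rw [← translate_symm]; rfl
  have hPP : ∀ g k, P g * P k = P (k + g) := by
    intro g k; ext1 x
    rw [Equiv.Perm.mul_apply, hP, hP, hP, Equiv.apply_symm_apply, translate_translate]
  have hP0 : P 0 = 1 := by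
    ext1 x
    rw [hP, translate_zero, Equiv.symm_apply_apply, Equiv.Perm.one_apply]
  have hst' : (s : ZMod n) ≠ t := fun h => hst (intCast_inj_of_lt hs.1 hs.2 ht.1 ht.2 h)
  let S : Multiset (SimpleGraph V) := (Finset.univ : Finset (ZMod n)).val.map fun g => F.map (P g)
  have hnone : ∀ x y b, ψ x = none → ψ y = some b →
      (F.Adj x y ↔ b = s ∨ b = t) := by
    intro x y b hx hy
    rw [hadj]
    simp only [Multiset.mem_cons, exists_eq_or_imp, hx, hy, labelVertex_neg_one,
      labelVertex_of_nonneg n hs.1, labelVertex_of_nonneg n ht.1]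
    constructor
    · rintro (h | h | ⟨e, he, h⟩)
      · left; simpa using h
      · right; simpa using h
      · have := hE e he
        rw [labelVertex_of_nonneg n this.1, labelVertex_of_nonneg n this.2.2.1] at h
        simp at h
    · rintro (rfl | rfl) <;> simp
  have hsome : ∀ x y a b, ψ x = some a → ψ y = some b → (F.Adj x y ↔ ∃ e ∈ E,
      (a = e.1 ∧ b = e.2) ∨ (b = e.1 ∧ a = e.2)) := by
    intro x y a b hx hy
    rw [hadj]
    simp only [Multiset.mem_cons, exists_eq_or_imp, hx, hy, labelVertex_neg_one]
    simp only [reduceCtorEq, false_and, and_false, false_or]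
    refine exists_congr fun e => and_congr_right fun he => ?_
    have := hE e he
    rw [labelVertex_of_nonneg n this.1, labelVertex_of_nonneg n this.2.2.1]
    simp
  have hcount : ∀ x y : V, S.countP (fun G => G.Adj x y) =
      (Finset.univ.filter fun g : ZMod n => F.Adj ((P g).symm x) ((P g).symm y)).card := by
    intro x y
    rw [Multiset.countP_map]
    simp only [map_perm_adj]
    rfl
  have hψ : ∀ g x, ψ ((P g).symm x) = translate (-g) (ψ x) := by
    intro g x; rw [hPs, Equiv.apply_symm_apply]
  have hcn : ∀ x y b, ψ x = none → ψ y = some b → S.countP (fun G => G.Adj x y) = 2 := by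
    intro x y b hx hy
    rw [hcount]
    have : (Finset.univ.filter fun g : ZMod n => F.Adj ((P g).symm x) ((P g).symm y)) =
        {b - (s : ZMod n), b - (t : ZMod n)} := by
      ext g
      simp only [Finset.mem_filter, Finset.mem_univ, true_and, Finset.mem_insert,
        Finset.mem_singleton]
      rw [hnone _ _ (b - g) (by rw [hψ, hx, translate_none])
        (by rw [hψ, hy, translate_some, sub_eq_add_neg])]
      constructor
      · rintro (h | h)
        · left; rw [← h]; ring
        · right; rw [← h]; ring
      · rintro (rfl | rfl)
        · left; ring
        · right; ring
    rw [this, Finset.card_pair fun h => hst' (sub_right_injective h)]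
  refine ⟨S, ⟨?_, ?_⟩, ?_⟩
  · intro G hG
    obtain ⟨g, -, rfl⟩ := Multiset.mem_map.1 hG
    exact ⟨(SimpleGraph.Iso.map (P g) F).symm⟩
  · intro x y hxy
    rcases hx : ψ x with _ | a <;> rcases hy : ψ y with _ | b
    · exact absurd (ψ.injective (hx.trans hy.symm)) hxy
    · convert hcn x y b hx hy
    · simp only [SimpleGraph.adj_comm _ x y]
      convert hcn y x a hy hx
    · have hab : a ≠ b := by
        rintro rfl
        exact hxy (ψ.injective (hx.trans hy.symm))
      rw [← card_translates hE hD hab]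
      convert hcount x y using 3 with g
      rw [hsome _ _ (a - g) (b - g) (by rw [hψ, hx, translate_some, sub_eq_add_neg])
        (by rw [hψ, hy, translate_some, sub_eq_add_neg])]
  · refine ⟨{ carrier := Set.range P, mul_mem' := ?_, one_mem' := ⟨0, hP0⟩, inv_mem' := ?_ }, ?_,
      ψ.symm none, ?_, ?_⟩
    · rintro _ _ ⟨g, rfl⟩ ⟨k, rfl⟩
      exact ⟨k + g, (hPP g k).symm⟩
    · rintro _ ⟨g, rfl⟩
      refine ⟨-g, ?_⟩
      rw [eq_inv_iff_mul_eq_one, hPP, add_neg_cancel, hP0]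
    · rintro _ ⟨g, rfl⟩
      change (Multiset.map _ S) = S
      simp only [S, Multiset.map_map, Function.comp_def, SimpleGraph.map_map]
      have : ∀ k, F.map (fun x => P g (P k x)) = F.map (P (k + g)) := by
        intro k; rw [← hPP]; rfl
      simp only [this]
      -- Applying a translation only reindexes the family by `k ↦ k + g`.
      conv_rhs => rw [← Finset.univ_map_equiv_to_embedding (Equiv.addRight g), Finset.map_val,
        Multiset.map_map]
      rfl
    · rintro _ ⟨g, rfl⟩
      rw [hP, Equiv.apply_symm_apply, translate_none]
    · intro x y hx hy
      obtain ⟨a, ha⟩ := Option.ne_none_iff_exists'.1 fun h => hx (ψ.symm_apply_eq.2 h.symm).symm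
      obtain ⟨b, hb⟩ := Option.ne_none_iff_exists'.1 fun h => hy (ψ.symm_apply_eq.2 h.symm).symm
      refine ⟨P (b - a), ⟨⟨_, rfl⟩, ?_⟩, ?_⟩
      · rw [hP, ha, translate_some, add_sub_cancel, ← hb, Equiv.symm_apply_apply]
      · rintro _ ⟨⟨g, rfl⟩, h⟩
        rw [hP, ha, translate_some, Equiv.symm_apply_eq, hb, Option.some_inj] at h
        rw [← h, add_sub_cancel_left]

/-! ### From lists of labels to unions of cycles -/

theorem coe_ofFn {α : Type*} {m : ℕ} (g : Fin m → α) :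
    ((List.ofFn g : List α) : Multiset α) = ∑ i, {g i} := by
  induction m with
  | zero => simp
  | succ m ih =>
    rw [List.ofFn_succ, Fin.sum_univ_succ, ← ih, Multiset.singleton_add, Multiset.cons_coe]

theorem pathEdges_ofFn {m : ℕ} (g : Fin (m + 1) → ℤ) :
    pathEdges (List.ofFn g) = ∑ i : Fin m, {(g i.castSucc, g i.succ)} := by
  induction m with
  | zero => simp [pathEdges]
  | succ m ih =>
    have := ih fun i => g i.succ
    rw [List.ofFn_succ] at this
    rw [List.ofFn_succ, List.ofFn_succ, pathEdges, this, Fin.sum_univ_succ, Multiset.singleton_add]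
    rfl

theorem cycleEdges_ofFn {m : ℕ} (g : Fin m → ℤ) :
    cycleEdges (List.ofFn g) = ∑ i, {(g i, g (finRotate m i))} := by
  cases m with
  | zero => simp [cycleEdges, pathEdges]
  | succ m =>
    rw [cycleEdges_eq (x := g 0) (y := g (Fin.last m)) (by simp [List.ofFn_succ])
      (by rw [List.ofFn_succ']; simp), pathEdges_ofFn, Fin.sum_univ_castSucc]
    simp only [finRotate_apply, Fin.coeSucc_eq_succ, Fin.last_add_one]

theorem cycleGraph_adj_iff {m : ℕ} (hm : 2 ≤ m) (a b : Fin m) :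
    (SimpleGraph.cycleGraph m).Adj a b ↔ b = finRotate m a ∨ a = finRotate m b := by
  obtain ⟨m, rfl⟩ : ∃ k, m = k + 2 := ⟨m - 2, by omega⟩
  rw [SimpleGraph.cycleGraph_adj, finRotate_apply, finRotate_apply, sub_eq_iff_eq_add,
    sub_eq_iff_eq_add, add_comm 1 b, add_comm 1 a, or_comm]

theorem cycleUnion_adj_iff {ι : Type*} {c : ι → ℕ} (hc : ∀ i, 2 ≤ c i) (x y : Σ i, Fin (c i)) :
    (cycleUnion c).Adj x y ↔ ∃ w : Σ i, Fin (c i),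
      (x = w ∧ y = ⟨w.1, finRotate _ w.2⟩) ∨ (y = w ∧ x = ⟨w.1, finRotate _ w.2⟩) := by
  constructor
  · rintro ⟨i, a, b, rfl, rfl, h⟩
    rcases (cycleGraph_adj_iff (hc i) a b).1 h with rfl | rfl
    · exact ⟨⟨i, a⟩, Or.inl ⟨rfl, rfl⟩⟩
    · exact ⟨⟨i, b⟩, Or.inr ⟨rfl, rfl⟩⟩
  · rintro ⟨⟨i, a⟩, ⟨rfl, rfl⟩ | ⟨rfl, rfl⟩⟩
    · exact ⟨i, _, _, rfl, rfl, (cycleGraph_adj_iff (hc i) _ _).2 (Or.inl rfl)⟩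
    · exact ⟨i, _, _, rfl, rfl, (cycleGraph_adj_iff (hc i) _ _).2 (Or.inr rfl)⟩

/-- The development of a labelled union of cycles. -/
theorem exists_oneRotational_of_cycles {V : Type*} (F : SimpleGraph V) {ι : Type*} [Fintype ι]
    {c : ι → ℕ} (hc : ∀ i, 2 ≤ c i) (hF : Nonempty (F ≃g cycleUnion c)) {n : ℕ} [NeZero n]
    (f : ∀ i, Fin (c i) → ℤ) {s t : ℤ} {E : Multiset (ℤ × ℤ)} (hs : 0 ≤ s ∧ s < n)
    (ht : 0 ≤ t ∧ t < n) (hst : s ≠ t)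
    (hE : ∀ e ∈ E, 0 ≤ e.1 ∧ e.1 < n ∧ 0 ≤ e.2 ∧ e.2 < n)
    (hD : E.map edgeDiff = Ico 1 (n : ℤ))
    (hverts : ∑ i, ((List.ofFn (f i) : List ℤ) : Multiset ℤ) = Ico (-1) (n : ℤ))
    (hedges : ∑ i, cycleEdges (List.ofFn (f i)) = (-1, s) ::ₘ (t, -1) ::ₘ E) :
    ∃ S : Multiset (SimpleGraph V), IsFactorization 2 F S ∧ IsOneRotational S := by
  obtain ⟨φ⟩ := hF
  let f' : (Σ i, Fin (c i)) → ℤ := fun w => f w.1 w.2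
  have hv : (Finset.univ : Finset (Σ i, Fin (c i))).val.map f' = Ico (-1) (n : ℤ) := by
    rw [← hverts, ← Multiset.sum_map_singleton (Multiset.map f' _), Multiset.map_map]
    change ∑ w, ({f' w} : Multiset ℤ) = _
    simp only [coe_ofFn, Fintype.sum_sigma, f']
  have he : (Finset.univ : Finset (Σ i, Fin (c i))).val.map
      (fun w => (f' w, f w.1 (finRotate _ w.2))) = (-1, s) ::ₘ (t, -1) ::ₘ E := by
    rw [← hedges, ← Multiset.sum_map_singleton (Multiset.map _ _), Multiset.map_map]
    change ∑ w : Σ i, Fin (c i), ({(f' w, f w.1 (finRotate _ w.2))} : Multiset (ℤ × ℤ)) = _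
    simp only [cycleEdges_ofFn, Fintype.sum_sigma, f']
  have hmem : ∀ w, -1 ≤ f' w ∧ f' w < n := by
    intro w
    rw [← Multiset.mem_Ico, ← hv]
    exact Multiset.mem_map_of_mem _ (Finset.mem_univ w)
  have hinj : ∀ w w', f' w = f' w' → w = w' := fun w w' h =>
    Multiset.inj_on_of_nodup_map (s := (Finset.univ : Finset (Σ i, Fin (c i))).val)
      (by rw [hv]; exact Multiset.nodup_Ico) w (Finset.mem_univ _) w' (Finset.mem_univ _) h
  have hlab : ∀ x y : ℤ, -1 ≤ x → x < n → -1 ≤ y → y < n →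
      labelVertex n x = labelVertex n y → x = y := by
    intro x y hx hxn hy hyn h
    rcases hx.lt_or_eq with hx | rfl <;> rcases hy.lt_or_eq with hy | rfl
    · rw [labelVertex_of_nonneg n (by omega), labelVertex_of_nonneg n (by omega),
        Option.some_inj] at h
      exact intCast_inj_of_lt (by omega) hxn (by omega) hyn h
    · rw [labelVertex_of_nonneg n (by omega), labelVertex_neg_one] at h
      simp at h
    · rw [labelVertex_of_nonneg n (x := y) (by omega), labelVertex_neg_one] at h
      simp at h
    · rfl
  have hsurj : ∀ x : ℤ, -1 ≤ x → x < n → ∃ w, f' w = x := by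
    intro x h1 h2
    have : x ∈ Ico (-1) (n : ℤ) := Multiset.mem_Ico.2 ⟨h1, h2⟩
    rw [← hv] at this
    obtain ⟨w, -, hw⟩ := Multiset.mem_map.1 this
    exact ⟨w, hw⟩
  let e : (Σ i, Fin (c i)) ≃ Option (ZMod n) := Equiv.ofBijective (fun w => labelVertex n (f' w)) (by
    constructor
    · intro w w' h
      exact hinj w w' (hlab _ _ (hmem w).1 (hmem w).2 (hmem w').1 (hmem w').2 h)
    · rintro (_ | a)
      · obtain ⟨w, hw⟩ := hsurj (-1) le_rfl (by omega)
        exact ⟨w, by simp only [hw, labelVertex_neg_one]⟩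
      · obtain ⟨x, h0, hx, rfl⟩ := exists_intCast_eq a
        obtain ⟨w, hw⟩ := hsurj x (by omega) hx
        exact ⟨w, by simp only [hw, labelVertex_of_nonneg n h0]⟩)
  refine exists_oneRotational F (φ.toEquiv.trans e) hs ht hst hE hD fun x y => ?_
  rw [← φ.map_adj_iff, cycleUnion_adj_iff hc, ← he]
  have heq : ∀ (u : V) (w : Σ i, Fin (c i)),
      (φ.toEquiv.trans e) u = labelVertex n (f' w) ↔ φ u = w :=
    fun u w => (e.injective.eq_iff (a := φ u) (b := w))
  constructor
  · rintro ⟨w, h⟩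
    refine ⟨_, Multiset.mem_map_of_mem _ (Finset.mem_univ w), ?_⟩
    rcases h with ⟨h1, h2⟩ | ⟨h1, h2⟩
    · exact Or.inl ⟨(heq _ _).2 h1, (heq y ⟨w.1, finRotate _ w.2⟩).2 h2⟩
    · exact Or.inr ⟨(heq _ _).2 h1, (heq x ⟨w.1, finRotate _ w.2⟩).2 h2⟩
  · rintro ⟨p, hp, h⟩
    obtain ⟨w, -, rfl⟩ := Multiset.mem_map.1 hp
    refine ⟨w, ?_⟩
    rcases h with ⟨h1, h2⟩ | ⟨h1, h2⟩
    · exact Or.inl ⟨(heq _ _).1 h1, (heq y ⟨w.1, finRotate _ w.2⟩).1 h2⟩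
    · exact Or.inr ⟨(heq _ _).1 h1, (heq x ⟨w.1, finRotate _ w.2⟩).1 h2⟩

theorem mem_of_mem_pathEdges {e : ℤ × ℤ} : ∀ {l : List ℤ}, e ∈ pathEdges l → e.1 ∈ l ∧ e.2 ∈ l
  | [], h => by simp [pathEdges] at h
  | [_], h => by simp [pathEdges] at h
  | a :: b :: l, h => by
    rw [pathEdges, Multiset.mem_cons] at h
    rcases h with rfl | h
    · simp
    · have := mem_of_mem_pathEdges h
      exact ⟨List.mem_cons_of_mem _ this.1, List.mem_cons_of_mem _ this.2⟩

theorem mem_of_mem_cycleEdges {e : ℤ × ℤ} {c : List ℤ} (h : e ∈ cycleEdges c) :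
    e.1 ∈ c ∧ e.2 ∈ c := by
  have h1 : ∀ x ∈ c ++ c.head?.toList, x ∈ c := by
    intro x hx
    rcases List.mem_append.1 hx with hx | hx
    · exact hx
    · exact List.mem_of_mem_head? (Option.mem_toList.1 hx)
  have h2 := mem_of_mem_pathEdges h
  exact ⟨h1 _ h2.1, h1 _ h2.2⟩

theorem mem_of_mem_labEdges {e : ℤ × ℤ} {l : List ℤ} {cs : List (List ℤ)}
    (h : e ∈ labEdges l cs) : e.1 ∈ labVerts l cs ∧ e.2 ∈ labVerts l cs := by
  induction cs with
  | nil =>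
    simp only [labEdges, List.map_nil, List.sum_nil, add_zero] at h
    simpa [labVerts] using mem_of_mem_pathEdges h
  | cons c cs ih =>
    rw [labEdges_cons, Multiset.mem_add] at h
    rw [labVerts_cons, Multiset.mem_add, Multiset.mem_add, Multiset.mem_coe, Multiset.mem_coe]
    rcases h with h | h
    · exact ⟨Or.inl (mem_of_mem_cycleEdges h).1, Or.inl (mem_of_mem_cycleEdges h).2⟩
    · exact ⟨Or.inr (ih h).1, Or.inr (ih h).2⟩

theorem exists_ofFn_eq {α : Type*} {m : ℕ} {l : List α} (h : l.length = m) :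
    ∃ g : Fin m → α, List.ofFn g = l := by
  subst h
  exact ⟨l.get, List.ofFn_get l⟩

theorem exists_ofFn_ofFn_eq {m : ℕ} {l : Fin m → ℕ} {cs : List (List ℤ)}
    (h : cs.map List.length = List.ofFn l) :
    ∃ A : ∀ i, Fin (l i) → ℤ, cs = List.ofFn fun i => List.ofFn (A i) := by
  obtain ⟨B, rfl⟩ := exists_ofFn_eq (l := cs) (m := m) (by
    rw [← List.length_map List.length, h, List.length_ofFn])
  rw [List.map_ofFn, List.ofFn_inj] at h
  choose A hA using fun i => exists_ofFn_eq (l := B i) (congrFun h i)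
  exact ⟨A, by simp only [hA]⟩

theorem coe_flatten (cs : List (List ℤ)) :
    (cs.flatten : Multiset ℤ) = (cs.map (Multiset.ofList (α := ℤ))).sum := by
  induction cs with
  | nil => rfl
  | cons c cs ih => rw [List.flatten_cons, ← Multiset.coe_add, ih, List.map_cons, List.sum_cons]

theorem exists_oneRotational_of_goodLab {V : Type*} (F : SimpleGraph V) {h r s : ℕ}
    {l : Fin r → ℕ} {l' : Fin s → ℕ} (hh : 3 ≤ h) (hl : ∀ i, 3 ≤ l i) (hl' : ∀ j, 3 ≤ l' j)
    (hF : Nonempty (F ≃g cycleUnion (lengths h l l'))) {d : ℤ}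
    (hL : GoodLab (h - 1 + (∑ i, l i : ℕ) + (∑ j, l' j : ℕ)) d (List.ofFn l ++ List.ofFn l')) :
    ∃ S : Multiset (SimpleGraph V), IsFactorization 2 F S ∧ IsOneRotational S := by
  obtain ⟨t, p, cs, h1, h2, h3, h4, h5, -⟩ := hL
  obtain ⟨n, hn⟩ : ∃ n : ℕ, (h - 1 + (∑ i, l i : ℕ) + (∑ j, l' j : ℕ) : ℤ) = n :=
    ⟨h - 1 + (∑ i, l i) + (∑ j, l' j), by omega⟩
  rw [hn] at h4 h5
  have : NeZero n := ⟨by omega⟩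
  obtain ⟨as, bs, rfl, ha, hb⟩ := List.map_eq_append_iff.1 h3
  obtain ⟨A, rfl⟩ := exists_ofFn_ofFn_eq ha
  obtain ⟨B, rfl⟩ := exists_ofFn_ofFn_eq hb
  have hp : p.length = h - 1 := by
    have := congrArg Multiset.card h4
    rw [card_Ico_int, labVerts, List.flatten_append, Multiset.card_add, Multiset.coe_card,
      Multiset.coe_card, List.length_append, List.length_flatten, List.length_flatten, ha, hb,
      List.sum_ofFn, List.sum_ofFn] at this
    omega
  -- Prefixing `-1` restores the fixed point and closes the path into the `h`-cycle.
  obtain ⟨P, hP⟩ := exists_ofFn_eq (l := -1 :: p) (m := h) (by rw [List.length_cons]; omega)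
  have hmem : ∀ x ∈ labVerts p ((List.ofFn fun i => List.ofFn (A i)) ++
      List.ofFn fun i => List.ofFn (B i)), 0 ≤ x ∧ x < n := by
    intro x hx
    rwa [h4, Multiset.mem_Ico] at hx
  have hpmem : ∀ x ∈ p, 0 ≤ x ∧ x < n := fun x hx =>
    hmem x (Multiset.mem_add.2 (Or.inl hx))
  have hdp : d ∈ p := List.mem_of_mem_head? h1
  have htp : t ∈ p := List.mem_of_mem_getLast? h2
  have hnodup : p.Nodup := by
    have : (labVerts p ((List.ofFn fun i => List.ofFn (A i)) ++
      List.ofFn fun i => List.ofFn (B i))).Nodup := by rw [h4]; exact Multiset.nodup_Ico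
    exact Multiset.coe_nodup.1 (Multiset.nodup_of_le (Multiset.le_add_right _ _) this)
  have hdt : d ≠ t := by
    rintro rfl
    cases p with
    | nil => simp at h1
    | cons a q =>
      cases q with
      | nil => simp at hp; omega
      | cons b q =>
        rw [List.head?_cons, Option.some_inj] at h1
        subst h1
        rw [List.getLast?_cons_cons] at h2
        exact (List.nodup_cons.1 hnodup).1 (List.mem_of_mem_getLast? h2)
  refine exists_oneRotational_of_cycles F (c := lengths h l l') ?_ hF
    (f := fun i => match i with
      | none => P
      | some (Sum.inl i) => A i
      | some (Sum.inr j) => B j) (hpmem d hdp) (hpmem t htp) hdt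
    (E := labEdges p ((List.ofFn fun i => List.ofFn (A i)) ++ List.ofFn fun i => List.ofFn (B i)))
    ?_ h5 ?_ ?_
  · rintro (_ | i | j)
    · exact le_trans (by omega) hh
    · exact le_trans (by omega) (hl i)
    · exact le_trans (by omega) (hl' j)
  · intro e he
    have := mem_of_mem_labEdges he
    have q1 := hmem _ this.1
    have q2 := hmem _ this.2
    exact ⟨q1.1, q1.2, q2.1, q2.2⟩
  · rw [Fintype.sum_option, Fintype.sum_sum_type]
    change ((List.ofFn P : List ℤ) : Multiset ℤ) + (∑ i, ((List.ofFn (A i) : List ℤ) : Multiset ℤ) +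
      ∑ j, ((List.ofFn (B j) : List ℤ) : Multiset ℤ)) = _
    rw [hP, ← Multiset.cons_coe, Multiset.cons_add]
    have : (p : Multiset ℤ) + (∑ i, ((List.ofFn (A i) : List ℤ) : Multiset ℤ) +
        ∑ j, ((List.ofFn (B j) : List ℤ) : Multiset ℤ)) = Ico 0 (n : ℤ) := by
      rw [← h4, labVerts, List.flatten_append, ← Multiset.coe_add, coe_flatten, coe_flatten,
        List.map_ofFn, List.map_ofFn, List.sum_ofFn, List.sum_ofFn]
      rfl
    rw [this]
    apply eq_Ico_of_cover
    · rw [Multiset.card_cons, card_Ico_int]; omega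
    · intro x hx1 hx2
      rw [Multiset.mem_cons, Multiset.mem_Ico]; omega
  · rw [Fintype.sum_option, Fintype.sum_sum_type]
    change cycleEdges (List.ofFn P) + (∑ i, cycleEdges (List.ofFn (A i)) +
      ∑ j, cycleEdges (List.ofFn (B j))) = _
    have hPe : cycleEdges (-1 :: p) = (-1, d) ::ₘ (t, -1) ::ₘ pathEdges p := by
      have hlast : (-1 :: p).getLast? = some t := by
        rw [List.getLast?_cons, h2, Option.getD_some]
      have hhead := pathEdges_append (l := [(-1 : ℤ)]) (x := -1) rfl h1
      rw [cycleEdges_eq (x := -1) rfl hlast]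
      simp only [List.singleton_append] at hhead
      rw [hhead, pathEdges]
      simp only [← Multiset.singleton_add]
      abel
    rw [hP, hPe, labEdges, List.map_append, List.sum_append, List.map_ofFn, List.map_ofFn,
      List.sum_ofFn, List.sum_ofFn]
    simp only [Multiset.cons_add]
    rfl

/-! ### Translating lengths -/

theorem ofFn_even_eq {r : ℕ} {l : Fin r → ℕ} (hl : ∀ i, 3 ≤ l i ∧ Even (l i)) :
    (List.ofFn fun i => (l i - 4) / 2).map (fun k => 2 * k + 4) = List.ofFn l := by
  rw [List.map_ofFn]
  congr 1
  ext i
  obtain ⟨h3, m, hm⟩ := hl i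
  simp only [Function.comp]
  omega

theorem ofFn_odd_eq {s : ℕ} {l' : Fin s → ℕ} (hl' : ∀ j, 3 ≤ l' j ∧ Odd (l' j)) :
    (List.ofFn fun j => (l' j - 3) / 2).map (fun k => 2 * k + 3) = List.ofFn l' := by
  rw [List.map_ofFn]
  congr 1
  ext i
  obtain ⟨h3, m, hm⟩ := hl' i
  simp only [Function.comp]
  omega

theorem mem_ofFn_half_le {r a : ℕ} (l : Fin r → ℕ) :
    ∀ k ∈ List.ofFn (fun i => (l i - a) / 2), k ≤ (Finset.univ.sup l - a) / 2 := by
  intro k hk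
  obtain ⟨i, rfl⟩ := List.mem_ofFn.1 hk
  have : l i ≤ Finset.univ.sup l := Finset.le_sup (Finset.mem_univ i)
  omega

theorem le_sup_of_pos {r a : ℕ} {l : Fin r → ℕ} (hr : 0 < r) (hl : ∀ i, a ≤ l i) :
    a ≤ Finset.univ.sup l :=
  (hl ⟨0, hr⟩).trans (Finset.le_sup (Finset.mem_univ _))

theorem sup_le_sum {s : ℕ} (l' : Fin s → ℕ) : Finset.univ.sup l' ≤ ∑ j, l' j :=
  Finset.sup_le fun _ hj => Finset.single_le_sum (fun _ _ => Nat.zero_le _) hj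

/-- The gadget for an even cycle of length `a` occupies `3a / 2 - 1` labels, at most `a` plus the
maximal length. -/
theorem evenSize_ofFn_le {r : ℕ} {l : Fin r → ℕ} (hl : ∀ i, 3 ≤ l i ∧ Even (l i)) :
    evenSize (List.ofFn fun i => (l i - 4) / 2) ≤ ∑ i, l i + r * Finset.univ.sup l := by
  rw [evenSize, List.map_ofFn, List.sum_ofFn]
  have : ∑ i, l i + r * Finset.univ.sup l = ∑ i, (l i + Finset.univ.sup l) := by
    rw [Finset.sum_add_distrib, Finset.sum_const, Finset.card_univ, Fintype.card_fin, smul_eq_mul]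
  rw [this]
  refine Finset.sum_le_sum fun i _ => ?_
  have h1 : l i ≤ Finset.univ.sup l := Finset.le_sup (Finset.mem_univ i)
  obtain ⟨h3, m, hm⟩ := hl i
  simp only [Function.comp]
  omega

end Oberwolfach

/-! ### The theorem -/

theorem theorem1p3 {V : Type*} [Finite V] (F : SimpleGraph V)
    (h r s : ℕ) (l : Fin r → ℕ) (l' : Fin s → ℕ)
    (hh : 3 ≤ h)
    (hl : ∀ i, 3 ≤ l i ∧ Even (l i)) (hl' : ∀ j, 3 ≤ l' j ∧ Odd (l' j))
    (hF : Nonempty (F ≃g Oberwolfach.cycleUnion (Oberwolfach.lengths h l l')))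
    (hbound :
      (0 < r ∧ 0 < s ∧
        12 * (r : ℤ) * ((Finset.univ.sup l : ℕ) + 3)
          + 7 ^ s * (2 * (Finset.univ.sup l' : ℕ) + 1) - 6 < (h : ℤ)) ∨
      (0 < r ∧ s = 0 ∧ 2 * (r + 1) * (Finset.univ.sup l + 1) + 5 < h) ∨
      (0 < s ∧ r = 0 ∧ 3 * 7 ^ (s - 1) * (2 * Finset.univ.sup l' + 1) < h)) :
    ∃ S : Multiset (SimpleGraph V),
      Oberwolfach.IsFactorization 2 F S ∧ Oberwolfach.IsOneRotational S := by
  open Oberwolfach in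
  suffices hd : ∃ d, GoodLab (h - 1 + (∑ i, l i : ℕ) + (∑ j, l' j : ℕ)) d
      (List.ofFn l ++ List.ofFn l') by
    obtain ⟨d, hd⟩ := hd
    exact exists_oneRotational_of_goodLab F hh (fun i => (hl i).1) (fun j => (hl' j).1) hF hd
  rw [← ofFn_even_eq hl, ← ofFn_odd_eq hl']
  rcases hbound with ⟨hr, hs, hb⟩ | ⟨hr, rfl, hb⟩ | ⟨hs, rfl, hb⟩
  -- With these parameters `2B + 7` and `4K + 7` become `ℓ + 3` and `2ℓ' + 1`. The additional `2K +
  -- 3` is at most `ℓ'` and is absorbed by the sum of the odd lengths.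
  · refine exists_goodLab_mixed (B := (Finset.univ.sup l - 4) / 2)
      (K := (Finset.univ.sup l' - 3) / 2) (by simpa using hr.ne') (by simpa using hs.ne')
      (mem_ofFn_half_le l) (mem_ofFn_half_le l') ?_
    rw [List.length_ofFn, List.length_ofFn]
    have h4 : 4 ≤ Finset.univ.sup l := le_sup_of_pos hr fun i => by
      obtain ⟨h3, m, hm⟩ := hl i
      omega
    have h3 : 3 ≤ Finset.univ.sup l' := le_sup_of_pos hs fun j => (hl' j).1
    have hsum := sup_le_sum l'
    have e1 : 12 * (r : ℤ) * (2 * ((Finset.univ.sup l - 4) / 2 : ℕ) + 7) ≤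
        12 * (r : ℤ) * ((Finset.univ.sup l : ℕ) + 3) :=
      mul_le_mul_of_nonneg_left (by omega) (by positivity)
    have e2 : (7 : ℤ) ^ s * (4 * ((Finset.univ.sup l' - 3) / 2 : ℕ) + 7) ≤
        7 ^ s * (2 * (Finset.univ.sup l' : ℕ) + 1) :=
      mul_le_mul_of_nonneg_left (by omega) (by positivity)
    omega
  · obtain ⟨d, hd⟩ := exists_goodLab_even (ks := List.ofFn fun i => (l i - 4) / 2)
      (n := h - 1 + (∑ i, l i : ℕ) + (∑ j, l' j : ℕ)) (by
        have := evenSize_ofFn_le hl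
        have e : 2 * (r + 1) * (Finset.univ.sup l + 1) =
          2 * (r * Finset.univ.sup l) + 2 * r + 2 * Finset.univ.sup l + 2 := by ring
        omega)
    exact ⟨d, by simpa using hd⟩
  · obtain ⟨d, hd⟩ := exists_goodLab_odd (js := List.ofFn fun j => (l' j - 3) / 2)
      (K := (Finset.univ.sup l' - 3) / 2) (n := h - 1 + (∑ i, l i : ℕ) + (∑ j, l' j : ℕ))
      (by simpa using hs.ne') (mem_ofFn_half_le l') (by
        have h3 : 3 ≤ Finset.univ.sup l' := le_sup_of_pos hs fun j => (hl' j).1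
        have e : (3 * 7 ^ (s - 1) : ℤ) * (4 * ((Finset.univ.sup l' - 3) / 2 : ℕ) + 7) ≤
            3 * 7 ^ (s - 1) * (2 * Finset.univ.sup l' + 1) :=
          mul_le_mul_of_nonneg_left (by omega) (by positivity)
        have hb' : (3 * 7 ^ (s - 1) : ℤ) * (2 * Finset.univ.sup l' + 1) < h := by exact_mod_cast hb
        rw [List.length_ofFn]
        omega)
    exact ⟨d, by simpa using hd⟩
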